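/- **Trees and parity games.** Fix an integer $d\ge 1$ and let $\Sigma_d=\{\mathrm{Adam},\mathrm{Eve}\}\times\{1,\dots,d\}$. Trees are possibly infinite (coinductively defined) and finitely branching; $\langle a,T_1,\dots,T_k\rangle$ is the tree with root label $a$ and immediate subtrees $T_1,\dots,T_k$ ($k\ge 0$). A node labelled $(\wp,p)$ belongs to the player $\wp$ and has priority $p$. A *parity tree* is a tree over $\Sigma_d$ in which every node has at least one child. An infinite branch is won by Eve (Adam) if the greatest priority appearing infinitely often on it is even (odd). A strategy of a player $\wp$ chooses a child at every node belonging to $\wp$ that has a child; $\wp$ *wins* in a tree if $\wp$ has a strategy such that all infinite branches agreeing with it are won by $\wp$. **Extended trees.** For a set $\mathcal Z$ of variables, extended trees over $(\mathcal Z,\Sigma_d)$ are defined by coinduction: each of them is of the form $\langle a,T_1,\dots,T_k\rangle$ with $a\in\Sigma_d$ and $T_1,\dots,T_k$ extended trees over $(\mathcal Z,\Sigma_d)$; or a variable $z\in\mathcal Z$; or an explicit substitution $T[U/z]$, where $z\notin\mathcal Z$, $T$ is an extended tree over $(\mathcal Z\cup\{z\},\Sigma_d)$, and $U$ is an extended tree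 over $(\mathcal Z,\Sigma_d)$. (Here $T[U/z]$ is a formal constructor: no substitution is performed.) Let $\rightarrowtail$ be the least relation between extended trees over $(\emptyset,\Sigma_d)$ such that $$\langle a,T_1,\dots,T_k\rangle[L_1/z_1]\cdots[L_\ell/z_\ell]\ \rightarrowtail\ \langle a,\,T_1[L_1/z_1]\cdots[L_\ell/z_\ell],\,\dots,\,T_k[L_1/z_1]\cdots[L_\ell/z_\ell]\rangle ,$$ $$z_i[L_1/z_1]\cdots[L_\ell/z_\ell]\ \rightarrowtail\ L_i[L_{i+1}/z_{i+1}]\cdots[L_\ell/z_\ell].$$ The *expansion* $\mathsf{BT}^{\mathsf s}(T)$ of an extended tree $T$ over $(\emptyset,\Sigma_d)$ is defined by coinduction: if $T\rightarrowtail^*\langle a,T_1,\dots,T_k\rangle$, then $\mathsf{BT}^{\mathsf s}(T)=\langle a,\mathsf{BT}^{\mathsf s}(T_1),\dots,\mathsf{BT}^{\mathsf s}(T_k)\rangle$; otherwise $\mathsf{BT}^{\mathsf s}(T)=\langle\omega\rangle$ for a special symbol $\omega\notin\Sigma_d$. An *extended parity tree* over $(\emptyset,\Sigma_d)$ is an extended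 tree over $(\emptyset,\Sigma_d)$ whose expansion is a parity tree. **The transformation.** For $r\ge 1$ and $p\in\{1,\dots,d\}$ let $r{\restriction}_p=p+1$ if $p$ is odd and $p>r$; $r{\restriction}_p=p-1$ if $p$ is even and $p\ge r$; and $r{\restriction}_p=r$ otherwise. For a function $Z$ from a set of variables to positive integers put $(Z{\restriction}_p)(z)=Z(z){\restriction}_p$, and let $Z[z\mapsto r]$ be $Z$ extended by the value $r$ at $z$. Let $\top=\langle(\mathrm{Eve},2),\top\rangle$ and $\bot=\langle(\mathrm{Eve},1),\bot\rangle$. For an extended tree $T$ over $(\mathrm{dom}(Z),\Sigma_d)$ the tree $\mathsf{tr}^{\mathsf t}_d(Z,T)$ is defined by coinduction: * $\mathsf{tr}^{\mathsf t}_d(Z,z)=\top$ if $Z(z)$ is odd, and $\mathsf{tr}^{\mathsf t}_d(Z,z)=\bot$ if $Z(z)$ is even; * $\mathsf{tr}^{\mathsf t}_d(Z,\langle(\wp,p),K_1,\dots,K_k\rangle)=\langle(\wp,p),\mathsf{tr}^{\mathsf t}_d(Z{\restriction}_p,K_1),\dots,\mathsf{tr}^{\mathsf t}_d(Z{\restriction}_p,K_k)\rangle$;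 * $\mathsf{tr}^{\mathsf t}_d(Z,T[U/z])=\langle(\mathrm{Eve},1),T_1^U,\dots,T_d^U,T_{2d}\rangle$, where $T_r=\mathsf{tr}^{\mathsf t}_d(Z[z\mapsto r],T)$ for $r\in\{1,\dots,d,2d\}$, and $T_r^U=\langle(\mathrm{Adam},1),T_r,\langle(\mathrm{Eve},r),\mathsf{tr}^{\mathsf t}_d(Z{\restriction}_r,U)\rangle\rangle$ for $r\in\{1,\dots,d\}$. **Lemma.** Let $T$ be an extended parity tree over $(\emptyset,\Sigma_d)$ and let $\wp\in\{\mathrm{Adam},\mathrm{Eve}\}$. If $\wp$ wins in $\mathsf{tr}^{\mathsf t}_d(\emptyset,T)$, where $\emptyset$ is the function with empty domain, then $\wp$ wins also in $\mathsf{BT}^{\mathsf s}(T)$. -/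

import Mathlib

namespace ParityExpansion

universe u

/-! ### Players, symbols, possibly infinite trees -/

/-- The two players. -/
inductive Player where
  | Adam
  | Eve

/-- Symbols labelling nodes: `lab w p` is the pair `(w, p)` of an owner and a priority, and `omega`
is the special symbol marking places where an expansion diverges. -/
inductive Symb where
  | lab (w : Player) (p : ℕ)
  | omega

/-- The alphabet `Σ_d = {Adam, Eve} × {1, …, d}`. -/
def Alphabet (d : ℕ) : Set Symb :=
  {a | ∃ w p, 1 ≤ p ∧ p ≤ d ∧ a = Symb.lab w p}

/-- One layer of a tree: a symbol and a finite number `k` of (ordered) children. -/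
abbrev treeShape : PFunctor.{0, 0} := ⟨Symb × ℕ, fun s => Fin s.2⟩

/-- Possibly infinite trees (the final coalgebra of `treeShape`). -/
def PTree : Type := treeShape.M

namespace PTree

/-- The tree `⟨a, T_1, …, T_k⟩`; children are indexed by `0, …, k - 1`. -/
def node (a : Symb) (k : ℕ) (ts : Fin k → PTree) : PTree :=
  PFunctor.M.mk (F := treeShape) ⟨(a, k), ts⟩

/-- The label of the root. -/
def label (T : PTree) : Symb := (PFunctor.M.dest (F := treeShape) T).1.1

/-- The number of children of the root. -/
def arity (T : PTree) : ℕ := (PFunctor.M.dest (F := treeShape) T).1.2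

/-- The subtree starting at the `i`-th child of the root. -/
def child (T : PTree) (i : Fin T.arity) : PTree := (PFunctor.M.dest (F := treeShape) T).2 i

/-- The subtree of `T` starting at the node `v`, or `none` if `v` is not a node of `T`. Nodes are
finite sequences of child numbers, read from the root. -/
def subtree? : PTree → List ℕ → Option PTree
  | T, [] => some T
  | T, i :: v => if h : i < T.arity then subtree? (T.child ⟨i, h⟩) v else none

/-- The root of the tree belongs to player `w`. -/
def BelongsTo (T : PTree) (w : Player) : Prop := ∃ p, T.label = Symb.lab w p

/-- The root of the tree has priority `p`. -/
def HasPriority (T : PTree) (p : ℕ) : Prop := ∃ w, T.label = Symb.lab w p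

/-- A parity tree with priorities bounded by `d`: a tree over `Σ_d` in which every node has at
least one child. -/
def IsParityTree (d : ℕ) (T : PTree) : Prop :=
  ∀ v S, T.subtree? v = some S → S.label ∈ Alphabet d ∧ 1 ≤ S.arity

/-- The node reached after `n` steps along the sequence `ξ` of child numbers. -/
def pathNode (ξ : ℕ → ℕ) (n : ℕ) : List ℕ := (List.range n).map ξ

/-- `ξ` is an (infinite) branch of `T`. In a parity tree all branches are infinite. -/
def IsBranch (T : PTree) (ξ : ℕ → ℕ) : Prop :=
  ∀ n, ∃ S, T.subtree? (pathNode ξ n) = some S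

/-- The priority `p` appears infinitely often on the branch `ξ` of `T`. -/
def InfOften (T : PTree) (ξ : ℕ → ℕ) (p : ℕ) : Prop :=
  ∃ᶠ n in Filter.atTop, ∃ S, T.subtree? (pathNode ξ n) = some S ∧ S.HasPriority p

/-- The parity of the priorities that are favourable for a player. -/
def Favourable : Player → ℕ → Prop
  | Player.Eve, p => Even p
  | Player.Adam, p => Odd p

/-- The branch `ξ` of `T` is won by `w`: the greatest priority appearing infinitely often on it is
even if `w` is Eve, and odd if `w` is Adam. -/
def BranchWonBy (T : PTree) (w : Player) (ξ : ℕ → ℕ) : Prop :=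
  ∃ p, IsGreatest {q | InfOften T ξ q} p ∧ Favourable w p

/-- `ρ` is a strategy of `w` in `T`: at every node belonging to `w` it selects a child. (A node
without children, which does not occur in a parity tree, offers nothing to select. Values of `ρ`
elsewhere are irrelevant.) -/
def IsStrategy (T : PTree) (w : Player) (ρ : List ℕ → ℕ) : Prop :=
  ∀ v S, T.subtree? v = some S → S.BelongsTo w → 1 ≤ S.arity → ρ v < S.arity

/-- The branch `ξ` agrees with the strategy `ρ` of `w`. -/
def Agrees (T : PTree) (w : Player) (ρ : List ℕ → ℕ) (ξ : ℕ → ℕ) : Prop :=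
  ∀ n S, T.subtree? (pathNode ξ n) = some S → S.BelongsTo w → ξ n = ρ (pathNode ξ n)

/-- Player `w` wins in `T`: there is a strategy of `w` such that all branches that agree with it
are won by `w`. -/
def Wins (w : Player) (T : PTree) : Prop :=
  ∃ ρ : List ℕ → ℕ, T.IsStrategy w ρ ∧
    ∀ ξ : ℕ → ℕ, T.IsBranch ξ → T.Agrees w ρ ξ → T.BranchWonBy w ξ

end PTree

/-! ### Extended trees -/

/-- One layer of an extended tree: an ordinary node with `k` children, a variable, or an explicit
substitution for a variable. -/
inductive ExtHead (V : Type u) where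
  | node (a : Symb) (k : ℕ)
  | var (z : V)
  | sub (z : V)

/-- Positions of the immediate constituents; for an explicit substitution `T[U/z]` these are `true`
(for `T`) and `false` (for `U`). -/
abbrev ExtHead.Pos {V : Type u} : ExtHead V → Type
  | .node _ k => Fin k
  | .var _ => Empty
  | .sub _ => Bool

/-- The polynomial functor of extended trees. -/
abbrev extShape (V : Type u) : PFunctor.{u, 0} := ⟨ExtHead V, ExtHead.Pos⟩

/-- Possibly infinite extended trees with variables from `V`, scoping being described
separately by `ExtTree.IsOver`. -/
def ExtTree (V : Type u) : Type u := (extShape V).M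

namespace ExtTree

variable {V : Type u}

/-- The extended tree `⟨a, T_1, …, T_k⟩`. -/
def node (a : Symb) (k : ℕ) (ts : Fin k → ExtTree V) : ExtTree V :=
  PFunctor.M.mk (F := extShape V) ⟨ExtHead.node a k, ts⟩

/-- The extended tree consisting of the variable `z`. -/
def var (z : V) : ExtTree V :=
  PFunctor.M.mk (F := extShape V) ⟨ExtHead.var z, fun e : Empty => e.elim⟩

/-- The explicit substitution `T[U/z]`. -/
def sub (T U : ExtTree V) (z : V) : ExtTree V :=
  PFunctor.M.mk (F := extShape V) ⟨ExtHead.sub z, fun b : Bool => if b then T else U⟩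

/-- `T` is an extended tree over `(Z, A)`, by coinduction: all labels are in `A`, every free variable
is in `Z`, and in `T[U/z]` over `(Z, A)` the variable `z` is not in `Z`, the tree `T` is over
`(Z ∪ {z}, A)` and the tree `U` is over `(Z, A)`. -/
def IsOver (Z : Set V) (A : Set Symb) (T : ExtTree V) : Prop :=
  ∃ R : Set V → ExtTree V → Prop, R Z T ∧ ∀ Z T, R Z T →
    (∃ a k ts, T = node a k ts ∧ a ∈ A ∧ ∀ i, R Z (ts i)) ∨
    (∃ z, T = var z ∧ z ∈ Z) ∨
    (∃ T' U z, T = sub T' U z ∧ z ∉ Z ∧ R (insert z Z) T' ∧ R Z U)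

/-- `T[L_1/z_1]…[L_l/z_l]` for the list `[(z_1, L_1), …, (z_l, L_l)]`. -/
def subs (T : ExtTree V) (l : List (V × ExtTree V)) : ExtTree V :=
  l.foldl (fun S q => sub S q.2 q.1) T

/-- The simplification relation. In the rule for variables, the variable refers to the innermost
explicit substitution for it; in an extended tree over `(∅, A)` the variables of nested
substitutions are distinct, and the side condition holds automatically. -/
inductive Simp : ExtTree V → ExtTree V → Prop
  | node (a : Symb) (k : ℕ) (ts : Fin k → ExtTree V) (l : List (V × ExtTree V)) :
      Simp (subs (node a k ts) l) (node a k fun i => subs (ts i) l)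
  | var (z : V) (U : ExtTree V) (l₁ l₂ : List (V × ExtTree V)) (h : ∀ q ∈ l₁, q.1 ≠ z) :
      Simp (subs (var z) (l₁ ++ (z, U) :: l₂)) (subs U l₂)

/-- `T` simplifies, in finitely many steps, to `⟨a, T_1, …, T_k⟩`. -/
def SimpTo (T : ExtTree V) (a : Symb) (k : ℕ) (ts : Fin k → ExtTree V) : Prop :=
  Relation.ReflTransGen Simp T (node a k ts)

open Classical in
/-- One step of the coinductive definition of the expansion. The chosen `a, k, ts` are unique, see
`ExtTree.expansion_of_simpTo` below. -/
noncomputable def expansionStep (T : ExtTree V) : treeShape (ExtTree V) :=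
  if h : ∃ q : Σ s : Symb × ℕ, Fin s.2 → ExtTree V, SimpTo T q.1.1 q.1.2 q.2 then
    h.choose
  else ⟨(Symb.omega, 0), Fin.elim0⟩

/-- The expansion of an extended tree: if `T` simplifies to `⟨a, T_1, …, T_k⟩`, then the expansion
of `T` is `⟨a, S_1, …, S_k⟩` with `S_i` the expansion of `T_i`; otherwise it is `⟨ω⟩`. -/
noncomputable def expansion : ExtTree V → PTree :=
  PFunctor.M.corec (F := treeShape) expansionStep

/-- An extended parity tree over `(∅, Σ_d)`: an extended tree over `(∅, Σ_d)` whose expansion is a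
parity tree. -/
def IsExtParityTree (d : ℕ) (T : ExtTree V) : Prop :=
  T.IsOver ∅ (Alphabet d) ∧ T.expansion.IsParityTree d

end ExtTree

/-! ### The transformation -/

/-- The declaration `r` shifted after seeing the priority `p`. -/
def shift (r p : ℕ) : ℕ :=
  if Odd p ∧ r < p then p + 1
  else if Even p ∧ r ≤ p then p - 1
  else r

/-- A partial assignment of declarations to variables, shifted after seeing the priority `p`. -/
def shiftAll {V : Type u} (Z : V → Option ℕ) (p : ℕ) : V → Option ℕ :=
  fun z => (Z z).map fun r => shift r p

/-- Shift by the priority of a symbol (`omega` carries no priority). -/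
def shiftSymb {V : Type u} (Z : V → Option ℕ) : Symb → V → Option ℕ
  | .lab _ p => shiftAll Z p
  | .omega => Z

/-- States of the coinductive definition of the transformation. The names refer to the trees
generated from them:
* `tr Z T` is the transformed tree itself;
* `decl Z T U z r` is `⟨Adam, 1, T_r, ⟨Eve, r, tr (Z shifted by r) U⟩⟩`, where `T_r` is
  `tr (Z with z ↦ r) T`;
* `jump Z U r` is `⟨Eve, r, tr (Z shifted by r) U⟩`;
* `top` is the tree all of whose nodes are `(Eve, 2)`, and `bot` the one with all nodes `(Eve, 1)`,
  each node having one child. -/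
inductive TrState (V : Type u) where
  | tr (Z : V → Option ℕ) (T : ExtTree V)
  | decl (Z : V → Option ℕ) (T U : ExtTree V) (z : V) (r : ℕ)
  | jump (Z : V → Option ℕ) (U : ExtTree V) (r : ℕ)
  | top
  | bot

/-- One step of the transformation. A variable is always in the domain of `Z` when an extended tree
over `(dom Z, Σ_d)` is transformed. -/
def trStep {V : Type u} [DecidableEq V] (d : ℕ) : TrState V → treeShape (TrState V)
  | .tr Z T =>
    match PFunctor.M.dest (F := extShape V) T with
    | ⟨.node a k, ts⟩ => ⟨(a, k), fun i => .tr (shiftSymb Z a) (ts i)⟩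
    | ⟨.var z, _⟩ =>
      match Z z with
      | none => ⟨(Symb.omega, 0), Fin.elim0⟩
      | some r =>
        if Odd r then ⟨(Symb.lab .Eve 2, 1), fun _ => .top⟩
        else ⟨(Symb.lab .Eve 1, 1), fun _ => .bot⟩
    | ⟨.sub z, c⟩ =>
      ⟨(Symb.lab .Eve 1, d + 1), fun i : Fin (d + 1) =>
        if (i : ℕ) < d then .decl Z (c true) (c false) z (i + 1)
        else .tr (Function.update Z z (some (2 * d))) (c true)⟩
  | .decl Z T U z r =>
    ⟨(Symb.lab .Adam 1, 2), ![.tr (Function.update Z z (some r)) T, .jump Z U r]⟩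
  | .jump Z U r => ⟨(Symb.lab .Eve r, 1), fun _ => .tr (shiftAll Z r) U⟩
  | .top => ⟨(Symb.lab .Eve 2, 1), fun _ => .top⟩
  | .bot => ⟨(Symb.lab .Eve 1, 1), fun _ => .bot⟩

/-- The tree generated from a state. -/
def run {V : Type u} [DecidableEq V] (d : ℕ) : TrState V → PTree :=
  PFunctor.M.corec (F := treeShape) (trStep d)

/-- The transformed tree, for a partial assignment `Z` of declarations to variables. -/
def tr {V : Type u} [DecidableEq V] (d : ℕ) (Z : V → Option ℕ) (T : ExtTree V) : PTree :=
  run d (.tr Z T)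

/-- The assignment with empty domain. -/
def noDecl {V : Type u} : V → Option ℕ := fun _ => none

/-! ### The defining equations -/

/-- The tree all of whose nodes have label `a` and exactly one child. -/
def constTree (a : Symb) : PTree :=
  PFunctor.M.corec (F := treeShape) (X := Symb) (fun a => ⟨(a, 1), fun _ => a⟩) a

/-- The tree `⊤ = ⟨Eve, 2, ⊤⟩`, in which Eve wins. -/
def topTree : PTree := constTree (.lab .Eve 2)

/-- The tree `⊥ = ⟨Eve, 1, ⊥⟩`, in which Eve loses. -/
def botTree : PTree := constTree (.lab .Eve 1)

theorem topTree_eq : topTree = PTree.node (.lab .Eve 2) 1 fun _ => topTree :=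
  PFunctor.M.corec_def _ _

theorem botTree_eq : botTree = PTree.node (.lab .Eve 1) 1 fun _ => botTree :=
  PFunctor.M.corec_def _ _

section Equations

variable {V : Type u}

theorem run_eq [DecidableEq V] (d : ℕ) (s : TrState V) :
    run d s = PTree.node (trStep d s).1.1 (trStep d s).1.2 fun i => run d ((trStep d s).2 i) :=
  PFunctor.M.corec_def _ _

theorem run_const_eq [DecidableEq V] (d : ℕ) (s : TrState V) (a : Symb)
    (hs : trStep d s = ⟨(a, 1), fun _ => s⟩) : run d s = constTree a := by
  refine PFunctor.M.bisim (P := treeShape) (fun x y => x = run d s ∧ y = constTree a) ?_ _ _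
    ⟨rfl, rfl⟩
  rintro x y ⟨rfl, rfl⟩
  refine ⟨(a, 1), fun _ => run d s, fun _ => constTree a, ?_, ?_, fun _ => ⟨rfl, rfl⟩⟩
  · rw [run, PFunctor.M.dest_corec, hs]; rfl
  · exact PFunctor.M.dest_corec _ _

theorem run_top [DecidableEq V] (d : ℕ) : run d (TrState.top : TrState V) = topTree :=
  run_const_eq d _ _ rfl

theorem run_bot [DecidableEq V] (d : ℕ) : run d (TrState.bot : TrState V) = botTree :=
  run_const_eq d _ _ rfl

theorem tr_node [DecidableEq V] (d : ℕ) (Z : V → Option ℕ) (w : Player) (p k : ℕ)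
    (ts : Fin k → ExtTree V) :
    tr d Z (ExtTree.node (.lab w p) k ts) =
      PTree.node (.lab w p) k fun i => tr d (shiftAll Z p) (ts i) :=
  run_eq d _

theorem tr_var_odd [DecidableEq V] (d : ℕ) (Z : V → Option ℕ) (z : V) (r : ℕ)
    (hz : Z z = some r) (hr : Odd r) : tr d Z (ExtTree.var z) = topTree := by
  have h : trStep d (.tr Z (ExtTree.var z)) =
      ⟨(Symb.lab .Eve 2, 1), fun _ => TrState.top⟩ := by
    show (match Z z with
      | none => (⟨(Symb.omega, 0), Fin.elim0⟩ : treeShape (TrState V))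
      | some r =>
        if Odd r then ⟨(Symb.lab .Eve 2, 1), fun _ => .top⟩
        else ⟨(Symb.lab .Eve 1, 1), fun _ => .bot⟩) = _
    rw [hz]
    exact if_pos hr
  rw [tr, run_eq, h, topTree_eq, ← run_top (V := V) d]

theorem tr_var_even [DecidableEq V] (d : ℕ) (Z : V → Option ℕ) (z : V) (r : ℕ)
    (hz : Z z = some r) (hr : Even r) : tr d Z (ExtTree.var z) = botTree := by
  have h : trStep d (.tr Z (ExtTree.var z)) =
      ⟨(Symb.lab .Eve 1, 1), fun _ => TrState.bot⟩ := by
    show (match Z z with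
      | none => (⟨(Symb.omega, 0), Fin.elim0⟩ : treeShape (TrState V))
      | some r =>
        if Odd r then ⟨(Symb.lab .Eve 2, 1), fun _ => .top⟩
        else ⟨(Symb.lab .Eve 1, 1), fun _ => .bot⟩) = _
    rw [hz]
    exact if_neg (Nat.not_odd_iff_even.2 hr)
  rw [tr, run_eq, h, botTree_eq, ← run_bot (V := V) d]

theorem tr_sub [DecidableEq V] (d : ℕ) (Z : V → Option ℕ) (T U : ExtTree V) (z : V) :
    tr d Z (ExtTree.sub T U z) =
      PTree.node (.lab .Eve 1) (d + 1) fun i =>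
        if (i : ℕ) < d then
          PTree.node (.lab .Adam 1) 2
            ![tr d (Function.update Z z (some (i + 1))) T,
              PTree.node (.lab .Eve (i + 1)) 1 fun _ => tr d (shiftAll Z (i + 1)) U]
        else tr d (Function.update Z z (some (2 * d))) T := by
  have h : trStep d (.tr Z (ExtTree.sub T U z)) =
      ⟨(Symb.lab .Eve 1, d + 1), fun i : Fin (d + 1) =>
        if (i : ℕ) < d then .decl Z T U z (i + 1)
        else .tr (Function.update Z z (some (2 * d))) T⟩ := rfl
  rw [tr, run_eq, h]
  congr 1
  funext i
  by_cases hi : (i : ℕ) < d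
  · simp only [hi, if_true]
    rw [run_eq]
    show PTree.node (.lab .Adam 1) 2 _ = _
    congr 1
    funext j
    refine Fin.cases ?_ (fun j => ?_) j
    · rfl
    · rw [Subsingleton.elim j 0]
      exact run_eq d (.jump Z U (i + 1))
  · simp only [hi, if_false]
    rfl

namespace ExtTree

theorem subs_concat (T : ExtTree V) (l : List (V × ExtTree V)) (q : V × ExtTree V) :
    subs T (l ++ [q]) = sub (subs T l) q.2 q.1 := by
  simp [subs]

theorem sub_inj {T U T' U' : ExtTree V} {z z' : V} (h : sub T U z = sub T' U' z') :
    T = T' ∧ U = U' ∧ z = z' := by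
  have h := PFunctor.M.mk_inj h
  have h1 : z = z' := by
    exact ExtHead.sub.inj (congrArg Sigma.fst h)
  subst h1
  have h2 := eq_of_heq (Sigma.mk.inj h).2
  exact ⟨congrFun h2 true, congrFun h2 false, rfl⟩

theorem subs_inj {S S' : ExtTree V} (hS : ∀ T U z, S ≠ sub T U z) (hS' : ∀ T U z, S' ≠ sub T U z)
    (l : List (V × ExtTree V)) : ∀ l', subs S l = subs S' l' → S = S' ∧ l = l' := by
  induction l using List.reverseRecOn with
  | nil =>
    intro l' h
    rcases List.eq_nil_or_concat' l' with rfl | ⟨m, q, rfl⟩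
    · exact ⟨h, rfl⟩
    · rw [subs_concat] at h
      exact absurd h (hS _ _ _)
  | append_singleton l q ih =>
    intro l' h
    rcases List.eq_nil_or_concat' l' with rfl | ⟨m, q', rfl⟩
    · rw [subs_concat] at h
      exact absurd h.symm (hS' _ _ _)
    · rw [subs_concat, subs_concat] at h
      obtain ⟨h1, h2, h3⟩ := sub_inj h
      obtain ⟨h4, rfl⟩ := ih m h1
      refine ⟨h4, ?_⟩
      rw [Prod.ext h3 h2]

theorem node_ne_sub (a : Symb) (k : ℕ) (ts : Fin k → ExtTree V) (T U : ExtTree V) (z : V) :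
    node a k ts ≠ sub T U z := fun h => by
  have := congrArg Sigma.fst (PFunctor.M.mk_inj h)
  simp at this

theorem var_ne_sub (y : V) (T U : ExtTree V) (z : V) : var y ≠ sub T U z := fun h => by
  have := congrArg Sigma.fst (PFunctor.M.mk_inj h)
  simp at this

theorem node_ne_var (a : Symb) (k : ℕ) (ts : Fin k → ExtTree V) (z : V) :
    node a k ts ≠ var z := fun h => by
  have := congrArg Sigma.fst (PFunctor.M.mk_inj h)
  simp at this

theorem var_inj {y z : V} (h : var y = var z) : y = z :=
  ExtHead.var.inj (congrArg Sigma.fst (PFunctor.M.mk_inj h))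

theorem node_inj {a a' : Symb} {k k' : ℕ} {ts : Fin k → ExtTree V} {ts' : Fin k' → ExtTree V}
    (h : node a k ts = node a' k' ts') :
    (⟨(a, k), ts⟩ : Σ s : Symb × ℕ, Fin s.2 → ExtTree V) = ⟨(a', k'), ts'⟩ := by
  have h := PFunctor.M.mk_inj h
  have h1 : a = a' ∧ k = k' := by
    exact ExtHead.node.inj (congrArg Sigma.fst h)
  obtain ⟨rfl, rfl⟩ := h1
  have h2 := eq_of_heq (Sigma.mk.inj h).2
  subst h2
  rfl

theorem split_unique {z : V} (l₁ : List (V × ExtTree V)) : ∀ {m₁ l₂ m₂ : List (V × ExtTree V)}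
    {U W : ExtTree V}, (∀ q ∈ l₁, q.1 ≠ z) → (∀ q ∈ m₁, q.1 ≠ z) →
    l₁ ++ (z, U) :: l₂ = m₁ ++ (z, W) :: m₂ → U = W ∧ l₂ = m₂ := by
  induction l₁ with
  | nil =>
    intro m₁ l₂ m₂ U W _ hm h
    cases m₁ with
    | nil => simpa using h
    | cons q m₁ =>
      simp only [List.nil_append, List.cons_append, List.cons.injEq] at h
      exact absurd (congrArg Prod.fst h.1).symm (hm q (by simp))
  | cons q l₁ ih =>
    intro m₁ l₂ m₂ U W hl hm h
    cases m₁ with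
    | nil =>
      simp only [List.nil_append, List.cons_append, List.cons.injEq] at h
      exact absurd (congrArg Prod.fst h.1) (hl q (by simp))
    | cons q' m₁ =>
      simp only [List.cons_append, List.cons.injEq] at h
      exact ih (fun q hq => hl q (by simp [hq])) (fun q hq => hm q (by simp [hq])) h.2

/-- The simplification relation is deterministic. -/
theorem Simp.unique {T U U' : ExtTree V} (h : Simp T U) (h' : Simp T U') : U = U' := by
  generalize hT : T = T' at h'
  cases h with
  | node a k ts l =>
    cases h' with
    | node a' k' ts' l' =>
      obtain ⟨h1, rfl⟩ := subs_inj (node_ne_sub _ _ _) (node_ne_sub _ _ _) _ _ hT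
      have h2 := node_inj h1
      simp only [Sigma.mk.injEq, Prod.mk.injEq] at h2
      obtain ⟨⟨rfl, rfl⟩, h3⟩ := h2
      rw [eq_of_heq h3]
    | var z W l₁ l₂ hl =>
      exact absurd (subs_inj (node_ne_sub _ _ _) (var_ne_sub _) _ _ hT).1 (node_ne_var _ _ _ _)
  | var z W l₁ l₂ hl =>
    cases h' with
    | node a' k' ts' l' =>
      exact absurd (subs_inj (var_ne_sub _) (node_ne_sub _ _ _) _ _ hT).1.symm
        (node_ne_var _ _ _ _)
    | var z' W' m₁ m₂ hm =>
      obtain ⟨h1, h2⟩ := subs_inj (var_ne_sub _) (var_ne_sub _) _ _ hT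
      obtain rfl := var_inj h1
      obtain ⟨rfl, rfl⟩ := split_unique _ hl hm h2
      rfl

theorem simp_node_self (a : Symb) (k : ℕ) (ts : Fin k → ExtTree V) :
    Simp (node a k ts) (node a k ts) := Simp.node a k ts []

theorem simpTo_unique {T : ExtTree V} {a a' : Symb} {k k' : ℕ} {ts : Fin k → ExtTree V}
    {ts' : Fin k' → ExtTree V} (h : SimpTo T a k ts) (h' : SimpTo T a' k' ts') :
    node a k ts = node a' k' ts' := by
  have fix : ∀ {b : Symb} {m : ℕ} {us : Fin m → ExtTree V} {S : ExtTree V},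
      Relation.ReflTransGen Simp (node b m us) S → S = node b m us := by
    intro b m us S hS
    induction hS with
    | refl => rfl
    | tail _ hs ih => subst ih; exact hs.unique (simp_node_self _ _ _)
  rw [SimpTo] at h
  induction h using Relation.ReflTransGen.head_induction_on with
  | refl => exact (fix h').symm
  | head hs hr ih =>
    rcases Relation.ReflTransGen.cases_head h' with rfl | ⟨c, hc, hc'⟩
    · obtain rfl := hs.unique (simp_node_self _ _ _)
      exact (fix hr)
    · obtain rfl := hs.unique hc
      exact ih hc'

/-- The defining equation of the expansion, when a node is eventually produced. -/
theorem expansion_of_simpTo {T : ExtTree V} {a : Symb} {k : ℕ} {ts : Fin k → ExtTree V}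
    (h : SimpTo T a k ts) : T.expansion = PTree.node a k fun i => (ts i).expansion := by
  have hs : expansionStep T = ⟨(a, k), ts⟩ := by
    have hex : ∃ q : Σ s : Symb × ℕ, Fin s.2 → ExtTree V, SimpTo T q.1.1 q.1.2 q.2 :=
      ⟨⟨(a, k), ts⟩, h⟩
    exact (dif_pos hex).trans (node_inj (simpTo_unique hex.choose_spec h))
  rw [expansion, PFunctor.M.corec_def, hs]
  rfl

/-- The defining equation of the expansion in the remaining case. -/
theorem expansion_of_not_simpTo {T : ExtTree V} (h : ∀ a k ts, ¬ SimpTo T a k ts) :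
    T.expansion = PTree.node Symb.omega 0 Fin.elim0 := by
  have hs : expansionStep T = ⟨(Symb.omega, 0), Fin.elim0⟩ := by
    refine dif_neg ?_
    rintro ⟨q, hq⟩
    exact h _ _ _ hq
  rw [expansion, PFunctor.M.corec_def, hs]
  show PTree.node Symb.omega 0 (expansion ∘ Fin.elim0) = _
  rw [Subsingleton.elim (expansion ∘ Fin.elim0) Fin.elim0]

end ExtTree

end Equations

end ParityExpansion

namespace ParityExpansion

universe u

/-! Let `ρ` be a winning strategy of `w` in the transformed tree. It guides a play in the expansion
by means of a shadow play in the transformed tree, which always agrees with `ρ` but is sometimes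
retracted. At an explicit substitution `T[U/z]` there is a declaration `r` with which the shadow
play may enter `T`, while suitable jumps to `U` stay in reserve (`exists_declaration`). Suppose that
`z` is reached later, and that `q` is the greatest priority the shadow play has seen since. The
declaration of `z` is now `r` shifted by `q`. The shadow play has agreed with `ρ`, so the constant
tree standing for `z` is won by `w`, and the declaration has the parity suiting `w`
(`not_favourable_of_cpath_var`). This is the case in which a reserved jump to `U` exists, through a
priority `r'` not better for `w` than `q`. The shadow play returns to the substitution and takes
this jump instead (`exists_simStep_var`).

The shadow play is stored as a stack of entries. An entry has a priority `prio`, seen in the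
transformed tree, and a `weight`, the greatest priority seen in the part of the expansion that it
stands for. The former is never better for `w` than the latter, and merging preserves this because
the order of gains is compatible with maxima (`gain_max`). An entry at a fixed height, once
everything below it is stable, changes at most once, from open to closed. So the stacks converge
(`exists_limit_of_stackSteps`), and the limit is an infinite play that agrees with `ρ` and hence is
won by `w`. Comparing priorities with weights shows that the limit superior of the weights is
favourable too (`favourable_of_simSteps`). Merging keeps the greatest weight, and steps that make no
move in the expansion have the least label `1`; thus this limit superior is that of the branch of
the expansion. -/

/-! ### The order of priorities -/

/-- The value of a priority for a player: favourable priorities are the better the greater they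
are, unfavourable ones the worse. -/
def gain : Player → ℕ → ℤ
  | .Eve, p => if Even p then p else -p
  | .Adam, p => if Even p then -p else p

/-- This lets an entrywise comparison of two plays pass to their greatest priorities, as needed when
entries are merged. -/
theorem gain_max {w : Player} {m p r q : ℕ} (h : gain w r ≤ gain w m) (h' : gain w q ≤ gain w p) :
    gain w (max r q) ≤ gain w (max m p) := by
  cases w <;> simp only [gain, Nat.even_iff] at * <;> split_ifs at * <;> omega

theorem favourable_of_gain {w : Player} {m r : ℕ} (hr : 1 ≤ r) (h : gain w r ≤ gain w m)
    (hf : PTree.Favourable w r) : PTree.Favourable w m ∧ r ≤ m := by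
  cases w <;> simp only [gain, PTree.Favourable, Nat.even_iff, Nat.odd_iff] at * <;>
    split_ifs at * <;> omega

theorem le_of_gain {w : Player} {m r : ℕ} (hm : 1 ≤ m) (h : gain w r ≤ gain w m)
    (hf : ¬ PTree.Favourable w m) : ¬ PTree.Favourable w r ∧ m ≤ r := by
  cases w <;> simp only [gain, PTree.Favourable, Nat.even_iff, Nat.odd_iff] at * <;>
    split_ifs at * <;> omega

/-! ### Infinitely often occurring values of a bounded sequence -/

/-- Pigeonhole principle: if each of the finitely many values were eventually avoided, all would be
avoided simultaneously. -/
theorem frequently_eq_of_frequently_between {f : ℕ → ℕ} {a b : ℕ}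
    (h : ∃ᶠ n in Filter.atTop, a ≤ f n ∧ f n ≤ b) :
    ∃ q, a ≤ q ∧ q ≤ b ∧ ∃ᶠ n in Filter.atTop, f n = q := by
  by_contra! hc
  refine h ?_
  have : ∀ᶠ n in Filter.atTop, ∀ q ∈ Finset.Icc a b, f n ≠ q := by
    rw [Filter.eventually_all_finset]
    intro q hq
    rw [Finset.mem_Icc] at hq
    exact hc q hq.1 hq.2
  filter_upwards [this] with n hn hab
  exact hn _ (Finset.mem_Icc.2 hab) rfl

theorem eventually_le_of_frequently_eq {f : ℕ → ℕ} {b P : ℕ} (hb : ∀ n, f n ≤ b)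
    (h : ∀ q, (∃ᶠ n in Filter.atTop, f n = q) → q ≤ P) : ∀ᶠ n in Filter.atTop, f n ≤ P := by
  by_contra hc
  obtain ⟨q, hq, -, hf⟩ := frequently_eq_of_frequently_between (f := f) (a := P + 1) (b := b)
    ((Filter.not_eventually.1 hc).mono fun n hn => ⟨by omega, hb n⟩)
  have := h q hf
  omega

theorem exists_isGreatest_frequently {f : ℕ → ℕ} {b : ℕ} (hb : ∀ n, f n ≤ b) :
    ∃ P, IsGreatest {q | ∃ᶠ n in Filter.atTop, f n = q} P := by
  obtain ⟨q, -, -, hq⟩ := frequently_eq_of_frequently_between (f := f) (a := 0) (b := b)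
    (Filter.Frequently.of_forall fun n => ⟨Nat.zero_le _, hb n⟩)
  have hbd : BddAbove {q | ∃ᶠ n in Filter.atTop, f n = q} := by
    refine ⟨b, fun q hq => ?_⟩
    obtain ⟨n, rfl⟩ := Filter.Frequently.exists hq
    exact hb n
  exact ⟨_, Nat.sSup_mem ⟨q, hq⟩ hbd, fun _ h => le_csSup hbd h⟩

/-! ### Subtrees and conforming paths -/

namespace PTree

theorem eq_node (T : PTree) : T = node T.label T.arity T.child :=
  (PFunctor.M.mk_dest (F := treeShape) T).symm

@[simp] theorem label_node (a : Symb) (k : ℕ) (ts : Fin k → PTree) : (node a k ts).label = a :=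
  congrArg (fun s => s.1.1) (PFunctor.M.dest_mk (F := treeShape) ⟨(a, k), ts⟩)

@[simp] theorem arity_node (a : Symb) (k : ℕ) (ts : Fin k → PTree) : (node a k ts).arity = k :=
  congrArg (fun s => s.1.2) (PFunctor.M.dest_mk (F := treeShape) ⟨(a, k), ts⟩)

theorem node_inj {a a' : Symb} {k k' : ℕ} {ts : Fin k → PTree} {ts' : Fin k' → PTree}
    (h : node a k ts = node a' k' ts') : a = a' ∧ k = k' ∧ HEq ts ts' := by
  have h := PFunctor.M.mk_inj h
  have h1 := congrArg Sigma.fst h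
  simp only [Prod.mk.injEq] at h1
  obtain ⟨rfl, rfl⟩ := h1
  exact ⟨rfl, rfl, (Sigma.mk.inj h).2⟩

theorem subtree?_node_singleton (a : Symb) (k : ℕ) (ts : Fin k → PTree) (i : ℕ) :
    (node a k ts).subtree? [i] = if h : i < k then some (ts ⟨i, h⟩) else none := by
  -- The tree is generalised because the type of its children depends on its arity, which blocks
  -- direct rewriting.
  have key : ∀ T : PTree, T = node a k ts →
      T.subtree? [i] = if h : i < k then some (ts ⟨i, h⟩) else none := by
    intro T hT
    have hT' := hT
    rw [eq_node T] at hT'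
    obtain ⟨-, rfl, h⟩ := node_inj hT'
    obtain rfl := eq_of_heq h
    rfl
  exact key _ rfl

theorem subtree?_append (T : PTree) (u v : List ℕ) :
    T.subtree? (u ++ v) = (T.subtree? u).bind fun S => S.subtree? v := by
  induction u generalizing T with
  | nil => rfl
  | cons i u ih =>
    simp only [List.cons_append, subtree?]
    split_ifs
    · exact ih _
    · rfl

/-- `CPath w ρ v S r u S'`: the node `u` with subtree `S'` is reached from the node `v` with
subtree `S` by at least one move, all moves being in agreement with the strategy `ρ` of `w`, and `r`
is the greatest priority of the nodes passed, including `v` and excluding `u`. -/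
inductive CPath (w : Player) (ρ : List ℕ → ℕ) : List ℕ → PTree → ℕ → List ℕ → PTree → Prop
  | single (v : List ℕ) (o : Player) (p k : ℕ) (ts : Fin k → PTree) (i : Fin k)
      (h : o = w → (i : ℕ) = ρ v) : CPath w ρ v (node (.lab o p) k ts) p (v ++ [(i : ℕ)]) (ts i)
  | trans {v S r u S' q x S''} (h : CPath w ρ v S r u S') (h' : CPath w ρ u S' q x S'') :
      CPath w ρ v S (max r q) x S''

theorem subtree?_concat_node {G : PTree} {v : List ℕ} {a : Symb} {k : ℕ} {ts : Fin k → PTree}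
    (h : G.subtree? v = some (node a k ts)) (i : Fin k) :
    G.subtree? (v ++ [(i : ℕ)]) = some (ts i) := by
  rw [subtree?_append, h]
  simp [subtree?_node_singleton]

variable {w : Player} {ρ : List ℕ → ℕ}

/-- Translates the inductive description of a finite path into data about the prefixes of its end
node, the form needed to glue infinitely many paths into one branch. -/
theorem CPath.spec {G : PTree} {v S r u S'} (h : CPath w ρ v S r u S')
    (hv : G.subtree? v = some S) :
    (∃ b, b ≠ [] ∧ u = v ++ b) ∧ G.subtree? u = some S' ∧
    (∀ n, v.length ≤ n → n < u.length → ∃ o p k, ∃ ts : Fin k → PTree,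
      G.subtree? (u.take n) = some (node (.lab o p) k ts) ∧ p ≤ r ∧
      (o = w → u[n]? = some (ρ (u.take n)))) ∧
    ∃ n, v.length ≤ n ∧ n < u.length ∧
      ∃ S, G.subtree? (u.take n) = some S ∧ S.HasPriority r := by
  induction h with
  | single v o p k ts i h =>
    refine ⟨⟨[(i : ℕ)], by simp, rfl⟩, subtree?_concat_node hv i, ?_, ?_⟩
    · intro n hn hn'
      simp only [List.length_append, List.length_singleton] at hn'
      obtain rfl : n = v.length := by omega
      refine ⟨o, p, k, ts, by simpa using hv, le_rfl, fun ho => ?_⟩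
      simp [h ho]
    · exact ⟨v.length, le_rfl, by simp, _, by simpa using hv, o, by simp⟩
  | @trans v S r u S' q x S'' _ _ ih ih' =>
    obtain ⟨⟨b, hb, rfl⟩, hu, h1, n1, hn1, hn1', S1, hS1, hp1⟩ := ih hv
    obtain ⟨⟨b', hb', rfl⟩, hx, h2, n2, hn2, hn2', S2, hS2, hp2⟩ := ih' hu
    have htake : ∀ n, n < (v ++ b).length → (v ++ b ++ b').take n = (v ++ b).take n :=
      fun n hn => List.take_append_of_le_length hn.le
    refine ⟨⟨b ++ b', by simp [hb], by simp⟩, hx, ?_, ?_⟩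
    · intro n hn hn'
      rcases lt_or_ge n (v ++ b).length with hlt | hge
      · obtain ⟨o, p, k, ts, h3, h4, h5⟩ := h1 n hn hlt
        refine ⟨o, p, k, ts, by rw [htake n hlt, h3], h4.trans (le_max_left _ _), fun ho => ?_⟩
        rw [htake n hlt, List.getElem?_append_left hlt, h5 ho]
      · obtain ⟨o, p, k, ts, h3, h4, h5⟩ := h2 n hge hn'
        exact ⟨o, p, k, ts, h3, h4.trans (le_max_right _ _), h5⟩
    · rcases le_total r q with hrq | hrq
      · rw [max_eq_right hrq]
        exact ⟨n2, by simp at hn2; omega, hn2', S2, hS2, hp2⟩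
      · rw [max_eq_left hrq]
        exact ⟨n1, hn1, by simp at hn1' ⊢; omega, S1, by rw [htake n1 hn1', hS1], hp1⟩

/-- Along an infinite play composed of finite paths that agree with a winning strategy, the limit
superior of the greatest priorities of these paths is favourable. -/
theorem favourable_of_cpaths {G : PTree}
    (hwin : ∀ ξ : ℕ → ℕ, G.IsBranch ξ → G.Agrees w ρ ξ → G.BranchWonBy w ξ)
    {v : ℕ → List ℕ} {S : ℕ → PTree} {r : ℕ → ℕ} {b : ℕ} (hb : ∀ k, r k ≤ b)
    (hv : v 0 = []) (hS : S 0 = G) (h : ∀ k, CPath w ρ (v k) (S k) (r k) (v (k + 1)) (S (k + 1))) :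
    ∃ R, Favourable w R ∧ (∃ᶠ k in Filter.atTop, R ≤ r k) ∧ ∀ᶠ k in Filter.atTop, r k ≤ R := by
  have hsub : ∀ k, G.subtree? (v k) = some (S k) := by
    intro k
    induction k with
    | zero => rw [hv, hS]; rfl
    | succ k ih => exact ((h k).spec ih).2.1
  have hpre : ∀ k, v k <+: v (k + 1) := fun k => by
    obtain ⟨b, -, hb⟩ := ((h k).spec (hsub k)).1
    exact ⟨b, hb.symm⟩
  have hpre' : ∀ {k l}, k ≤ l → v k <+: v l := fun {k l} hkl => by
    induction l, hkl using Nat.le_induction with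
    | base => exact List.prefix_rfl
    | succ l _ ih => exact ih.trans (hpre l)
  have hlen : ∀ k, (v k).length < (v (k + 1)).length := fun k => by
    obtain ⟨b, hb, hb'⟩ := ((h k).spec (hsub k)).1
    rw [hb', List.length_append]
    have := List.length_pos_iff.2 hb
    omega
  have hmono : StrictMono fun k => (v k).length := strictMono_nat_of_lt_succ hlen
  have hle : ∀ k, k ≤ (v k).length := fun _ => hmono.le_apply
  -- The nodes `v k` form a strictly growing chain of prefixes, and `ξ` is its union. The default
  -- `0` is never used, since `v (n + 1)` has more than `n` entries.
  let ξ : ℕ → ℕ := fun n => (v (n + 1)).getD n 0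
  have hξ : ∀ k i, i < (v k).length → (v k)[i]? = some (ξ i) := by
    intro k i hi
    have hi' : i < (v (i + 1)).length := hle (i + 1)
    have h2 : (v (i + 1))[i]? = some (ξ i) := by
      simp [ξ, List.getElem?_eq_getElem hi']
    rcases le_total k (i + 1) with hk | hk
    · obtain ⟨c, hc⟩ := hpre' hk
      rw [← h2, ← hc, List.getElem?_append_left hi]
    · obtain ⟨c, hc⟩ := hpre' hk
      rw [← h2, ← hc, List.getElem?_append_left hi']
  have hpath : ∀ k n, n ≤ (v k).length → pathNode ξ n = (v k).take n := by
    intro k n hn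
    refine List.ext_getElem? fun i => ?_
    rw [pathNode, List.getElem?_map, List.getElem?_take]
    split_ifs with hi
    · rw [hξ k i (by omega), List.getElem?_range hi]; rfl
    · rw [List.getElem?_eq_none (by simpa using hi)]; rfl
  have hblock : ∀ n, ∃ k, (v k).length ≤ n ∧ n < (v (k + 1)).length := by
    intro n
    have hex : ∃ k, n < (v k).length := ⟨n + 1, hle (n + 1)⟩
    have h1 := Nat.find_spec hex
    have h0 : Nat.find hex ≠ 0 := by
      intro h0
      rw [h0, hv] at h1
      simp at h1
    obtain ⟨k, hk⟩ := Nat.exists_eq_succ_of_ne_zero h0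
    refine ⟨k, ?_, by rw [hk] at h1; exact h1⟩
    exact not_lt.1 (Nat.find_min hex (m := k) (by omega))
  have hnode : ∀ n, ∃ k, (v k).length ≤ n ∧ n < (v (k + 1)).length ∧ ∃ o p j,
      ∃ ts : Fin j → PTree, G.subtree? (pathNode ξ n) = some (node (.lab o p) j ts) ∧ p ≤ r k ∧
      (o = w → ξ n = ρ (pathNode ξ n)) := by
    intro n
    obtain ⟨k, hk, hk'⟩ := hblock n
    obtain ⟨o, p, j, ts, h1, h2, h3⟩ := ((h k).spec (hsub k)).2.2.1 n hk hk'
    rw [← hpath _ _ hk'.le] at h1 h3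
    refine ⟨k, hk, hk', o, p, j, ts, h1, h2, fun ho => ?_⟩
    have := h3 ho
    rw [hξ _ _ hk'] at this
    exact Option.some.inj this
  obtain ⟨R, ⟨hR, hRmax⟩, hfav⟩ := hwin ξ
    (fun n => by obtain ⟨k, -, -, o, p, j, ts, h1, -⟩ := hnode n; exact ⟨_, h1⟩)
    (fun n S' hS' hw => by
      obtain ⟨k, -, -, o, p, j, ts, h1, -, h3⟩ := hnode n
      obtain rfl := Option.some.inj (hS'.symm.trans h1)
      obtain ⟨q, hq⟩ := hw
      rw [label_node] at hq
      exact h3 (Symb.lab.inj hq).1)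
  refine ⟨R, hfav, ?_, ?_⟩
  -- Each occurrence of `R` lies on one of the finite paths, whose maximum is then at least `R`.
  -- Conversely, each maximum is attained on its path, so maxima recurring infinitely often are at
  -- most `R`.
  · refine Filter.frequently_atTop.2 fun K => ?_
    obtain ⟨n, hn, S', hS', o', hp⟩ := Filter.frequently_atTop.1 hR (v K).length
    obtain ⟨k, -, hk, o, p, j, ts, h1, h2, -⟩ := hnode n
    obtain rfl := Option.some.inj (hS'.symm.trans h1)
    rw [label_node] at hp
    obtain ⟨-, rfl⟩ := Symb.lab.inj hp
    have := hmono.lt_iff_lt.1 (lt_of_le_of_lt hn hk)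
    exact ⟨k, by omega, h2⟩
  · refine eventually_le_of_frequently_eq hb fun q hq => hRmax ?_
    refine Filter.frequently_atTop.2 fun K => ?_
    obtain ⟨k, hk, rfl⟩ := Filter.frequently_atTop.1 hq K
    obtain ⟨n, hn, hn', S', hS', hp⟩ := ((h k).spec (hsub k)).2.2.2
    rw [← hpath _ _ hn'.le] at hS'
    exact ⟨n, hk.trans ((hle k).trans hn), S', hS', hp⟩

end PTree

/-! ### Sequences of stacks -/

section Stacks

variable {α : Type*}

/-- The entry of a stack at height `i`; the top of the stack is the head of the list. -/
def entryAt (A : List α) (i : ℕ) : Option α := A.reverse[i]?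

theorem entryAt_append (B C : List α) {i : ℕ} (hi : i < C.length) :
    entryAt (B ++ C) i = entryAt C i := by
  rw [entryAt, List.reverse_append, List.getElem?_append_left (by simpa using hi), entryAt]

theorem entryAt_cons (e : α) (C : List α) {i : ℕ} (hi : i < C.length) :
    entryAt (e :: C) i = entryAt C i :=
  entryAt_append [e] C hi

theorem entryAt_cons_length (e : α) (C : List α) : entryAt (e :: C) C.length = some e := by
  simp [entryAt]

theorem entryAt_append_of_le (B C : List α) {i : ℕ} (hi : C.length ≤ i) {e : α}
    (h : entryAt (B ++ C) i = some e) : e ∈ B := by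
  rw [entryAt, List.reverse_append, List.getElem?_append_right (by simpa using hi)] at h
  exact List.mem_reverse.1 (List.mem_of_getElem? h)

theorem exists_entryAt_append (B C : List α) {e : α} (h : e ∈ B) :
    ∃ i, C.length ≤ i ∧ entryAt (B ++ C) i = some e := by
  obtain ⟨i, hi⟩ := List.getElem?_of_mem (List.mem_reverse.2 h)
  refine ⟨C.length + i, by omega, ?_⟩
  rw [entryAt, List.reverse_append, List.getElem?_append_right (by simp)]
  simpa using hi

theorem lt_length_of_entryAt {A : List α} {i : ℕ} {e : α} (h : entryAt A i = some e) :
    i < A.length := by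
  simpa using (List.getElem?_eq_some_iff.1 h).1

theorem exists_entryAt {A : List α} {i : ℕ} (h : i < A.length) : ∃ e, entryAt A i = some e :=
  ⟨_, List.getElem?_eq_getElem (by simpa using h)⟩

/-- One step of a stack whose entries have weights `m`: an entry of weight `p` is put on the stack,
or, if `p = 1`, all entries down to an open one are merged into a single entry that is not open. -/
inductive StackStep (isOpen : α → Prop) (m : α → ℕ) : List α → ℕ → List α → Prop
  | push (A : List α) (e : α) (p : ℕ) (h : m e = p) : StackStep isOpen m A p (e :: A)
  | merge (B : List α) (f : α) (C : List α) (f' : α) (hf : isOpen f) (hf' : ¬ isOpen f')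
      (hle : ∀ e ∈ B ++ [f], m e ≤ m f') (heq : m f' = 1 ∨ ∃ e ∈ B ++ [f], m e = m f') :
      StackStep isOpen m (B ++ f :: C) 1 (f' :: C)

variable {isOpen : α → Prop} {m : α → ℕ}

/-- Convergence concerns entries at a fixed height, counted from the bottom; in these terms a step
leaves everything below one height unchanged and fills that height. -/
theorem StackStep.cases_entryAt {A A' : List α} {p : ℕ} (h : StackStep isOpen m A p A') :
    (A'.length = A.length + 1 ∧ (∀ i < A.length, entryAt A' i = entryAt A i) ∧
      ∃ e, entryAt A' A.length = some e ∧ m e = p) ∨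
    (p = 1 ∧ ∃ j, j < A.length ∧ A'.length = j + 1 ∧ (∀ i < j, entryAt A' i = entryAt A i) ∧
      ∃ f f', entryAt A j = some f ∧ entryAt A' j = some f' ∧ isOpen f ∧ ¬ isOpen f' ∧
      (∀ i e, j ≤ i → entryAt A i = some e → m e ≤ m f') ∧
      (m f' = 1 ∨ ∃ i e, j ≤ i ∧ entryAt A i = some e ∧ m e = m f')) := by
  cases h with
  | push _ _ _ hp =>
    exact Or.inl ⟨rfl, fun i hi => entryAt_cons _ _ hi, _, entryAt_cons_length _ _, hp⟩
  | merge B f C f' hf hf' hle heq =>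
    have hA : B ++ f :: C = (B ++ [f]) ++ C := by simp
    refine Or.inr ⟨rfl, C.length, by simp; omega, rfl, fun i hi => ?_, f, f', ?_,
      entryAt_cons_length _ _, hf, hf', fun i e hi he => ?_, heq.imp_right ?_⟩
    · rw [entryAt_cons _ _ hi, hA, entryAt_append _ _ hi]
    · rw [entryAt_append _ _ (by simp), entryAt_cons_length]
    · rw [hA] at he
      exact hle e (entryAt_append_of_le _ _ hi he)
    · rintro ⟨e, he, hm⟩
      obtain ⟨i, hi, hi'⟩ := exists_entryAt_append _ C he
      exact ⟨i, e, hi, by rw [hA]; exact hi', hm⟩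

/-! ### Limits of sequences of stacks -/

variable {A : ℕ → List α} {p : ℕ → ℕ} (h : ∀ t, StackStep isOpen m (A t) (p t) (A (t + 1)))
include h

/-- A sequence of stacks converges. -/
theorem exists_limit_of_stackSteps :
    ∃ E : ℕ → α, ∀ k, ∃ t₀, ∀ t, t₀ ≤ t → ∀ i, i ≤ k → entryAt (A t) i = some (E i) := by
  have key : ∀ k, ∃ e, ∃ t₀, ∀ t, t₀ ≤ t → entryAt (A t) k = some e := by
    intro k
    induction k using Nat.strong_induction_on with
    | _ k ih =>
    have hst : ∃ t₀, ∀ t, t₀ ≤ t → ∀ i, i < k → entryAt (A (t + 1)) i = entryAt (A t) i ∧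
        i < (A t).length := by
      choose! e t₀ ht₀ using ih
      refine ⟨(Finset.range k).sup t₀, fun t ht i hi => ?_⟩
      have h1 : t₀ i ≤ t := (Finset.le_sup (f := t₀) (Finset.mem_range.2 hi)).trans ht
      have h2 := ht₀ i hi t h1
      exact ⟨(ht₀ i hi (t + 1) (by omega)).trans h2.symm, lt_length_of_entryAt h2⟩
    obtain ⟨t₀, ht₀⟩ := hst
    have hk : ∀ t, t₀ ≤ t → k ≤ (A t).length := fun t ht => by
      by_contra hc
      have := (ht₀ t ht ((A t).length) (by omega)).2
      omega
    -- Once the heights below `k` are stable, no merge can happen there, since it would turn an open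
    -- entry into one that is not open.
    have hmerge : ∀ t, t₀ ≤ t → ∀ j f f', j < (A t).length → entryAt (A t) j = some f →
        entryAt (A (t + 1)) j = some f' → isOpen f → ¬ isOpen f' → k ≤ j := by
      intro t ht j f f' _ h1 h2 h3 h4
      by_contra hc
      have h5 := (ht₀ t ht j (by omega)).1
      rw [h1, h2] at h5
      exact h4 (Option.some.inj h5 ▸ h3)
    have hgrow : ∀ t, t₀ ≤ t → k < (A (t + 1)).length := by
      intro t ht
      rcases (h t).cases_entryAt with ⟨h1, -⟩ | ⟨-, j, hj, h1, -, f, f', h2, h3, h4, h5, -⟩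
      · have := hk t ht
        omega
      · have := hmerge t ht j f f' hj h2 h3 h4 h5
        omega
    have hchange : ∀ t, t₀ + 1 ≤ t → ∀ e, entryAt (A t) k = some e →
        entryAt (A (t + 1)) k = some e ∨
          (isOpen e ∧ ∃ e', ¬ isOpen e' ∧ entryAt (A (t + 1)) k = some e') := by
      intro t ht e he
      rcases (h t).cases_entryAt with ⟨-, h1, -⟩ | ⟨-, j, hj, -, h1, f, f', h2, h3, h4, h5, -⟩
      · exact Or.inl ((h1 k (lt_length_of_entryAt he)).trans he)
      · rcases (hmerge t (by omega) j f f' hj h2 h3 h4 h5).lt_or_eq with hlt | rfl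
        · exact Or.inl ((h1 k hlt).trans he)
        · obtain rfl := Option.some.inj (he.symm.trans h2)
          exact Or.inr ⟨h4, f', h5, h3⟩
    -- Only an open entry at height `k` can be replaced, and its replacement is not open; hence
    -- height `k` changes at most once more.
    have hclosed : ∀ t, t₀ + 1 ≤ t → ∀ e, ¬ isOpen e → entryAt (A t) k = some e →
        ∀ s, t ≤ s → entryAt (A s) k = some e := by
      intro t ht e he hte s hs
      induction s, hs using Nat.le_induction with
      | base => exact hte
      | succ s hs ih =>
        rcases hchange s (by omega) e ih with h1 | ⟨h1, -⟩
        · exact h1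
        · exact absurd h1 he
    obtain ⟨e, he⟩ := exists_entryAt (hgrow t₀ le_rfl)
    by_cases hex : ∃ s, t₀ + 1 ≤ s ∧ ∃ e', ¬ isOpen e' ∧ entryAt (A s) k = some e'
    · obtain ⟨s, hs, e', he', hs'⟩ := hex
      exact ⟨e', s, hclosed s hs e' he' hs'⟩
    · refine ⟨e, t₀ + 1, fun s hs => ?_⟩
      induction s, hs using Nat.le_induction with
      | base => exact he
      | succ s hs ih =>
        rcases hchange s hs e ih with h1 | ⟨-, e', h1, h2⟩
        · exact h1
        · exact absurd ⟨s + 1, by omega, e', h1, h2⟩ hex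
  choose E t₀ ht₀ using key
  refine ⟨E, fun k => ⟨(Finset.range (k + 1)).sup t₀, fun t ht i hi => ?_⟩⟩
  exact ht₀ i t ((Finset.le_sup (f := t₀) (Finset.mem_range.2 (by omega))).trans ht)

variable {E : ℕ → α}
  (hE : ∀ k, ∃ t₀, ∀ t, t₀ ≤ t → ∀ i, i ≤ k → entryAt (A t) i = some (E i))
include hE

/-- A weight greater than `1` that occurs infinitely often in the limit of a sequence of stacks is
put on the stack infinitely often. -/
theorem frequently_of_frequently_limit {q : ℕ} (hq : 1 < q)
    (hf : ∃ᶠ k in Filter.atTop, m (E k) = q) : ∃ᶠ t in Filter.atTop, p t = q := by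
  refine Filter.frequently_atTop.2 fun t₀ => ?_
  -- A weight above the height of the stack at time `t₀` was pushed since then or arose by merging
  -- such entries; the value `1` is the exception, because a merge may create it.
  have key : ∀ t, t₀ ≤ t → ∀ i e, (A t₀).length ≤ i → entryAt (A t) i = some e →
      m e = 1 ∨ ∃ s, t₀ ≤ s ∧ p s = m e := by
    intro t ht
    induction t, ht using Nat.le_induction with
    | base =>
      intro i e hi he
      have := lt_length_of_entryAt he
      omega
    | succ t ht ih =>
      intro i e hi he
      have hlt := lt_length_of_entryAt he
      rcases (h t).cases_entryAt with
        ⟨h0, h1, e', h2, h3⟩ | ⟨-, j, hj, h0, h1, f, f', -, h3, -, -, -, h4⟩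
      · rcases (show i ≤ (A t).length by omega).lt_or_eq with hlt | rfl
        · exact ih i e hi ((h1 i hlt).symm.trans he)
        · obtain rfl := Option.some.inj (he.symm.trans h2)
          exact Or.inr ⟨t, ht, h3.symm⟩
      · rcases (show i ≤ j by omega).lt_or_eq with hlt | rfl
        · exact ih i e hi ((h1 i hlt).symm.trans he)
        · obtain rfl := Option.some.inj (he.symm.trans h3)
          rcases h4 with h4 | ⟨i', e', h5, h6, h7⟩
          · exact Or.inl h4
          · rw [← h7]
            exact ih i' e' (hi.trans h5) h6
  obtain ⟨k, hk, hk'⟩ := Filter.frequently_atTop.1 hf (A t₀).length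
  obtain ⟨t₁, ht₁⟩ := hE k
  rcases key (max t₀ t₁) (le_max_left _ _) k _ hk (ht₁ _ (le_max_right _ _) k le_rfl) with h1 | h1
  · omega
  · rwa [hk'] at h1

/-- If a weight greater than `1` is put on the stack infinitely often, then infinitely many weights
in the limit of the sequence of stacks are at least as great. -/
theorem frequently_limit_of_frequently {q : ℕ} (hq : 1 < q)
    (hf : ∃ᶠ t in Filter.atTop, p t = q) : ∃ᶠ k in Filter.atTop, q ≤ m (E k) := by
  refine Filter.frequently_atTop.2 fun k => ?_
  obtain ⟨t₀, ht₀⟩ := hE k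
  obtain ⟨t₁, ht₁, hp⟩ := Filter.frequently_atTop.1 hf t₀
  -- The weight pushed at time `t₁` can only move down, into a merged entry at least as heavy. It
  -- never gets below `k`, as those heights are already stable, so some height in a bounded window
  -- keeps a weight of at least `q`.
  have key : ∀ t, t₁ + 1 ≤ t → ∃ i e, k ≤ i ∧ i ≤ (A t₁).length ∧ entryAt (A t) i = some e ∧
      q ≤ m e := by
    intro t ht
    induction t, ht using Nat.le_induction with
    | base =>
      rcases (h t₁).cases_entryAt with ⟨-, -, e, h1, h2⟩ | ⟨h1, -⟩
      · have := lt_length_of_entryAt (ht₀ t₁ ht₁ k le_rfl)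
        exact ⟨_, e, this.le, le_rfl, h1, by omega⟩
      · omega
    | succ t ht ih =>
      obtain ⟨i, e, hi, hi', he, hm⟩ := ih
      rcases (h t).cases_entryAt with
        ⟨-, h1, -⟩ | ⟨-, j, hj, -, h1, f, f', h2, h3, h4, h5, h6, -⟩
      · exact ⟨i, e, hi, hi', (h1 i (lt_length_of_entryAt he)).trans he, hm⟩
      · rcases lt_or_ge i j with hlt | hge
        · exact ⟨i, e, hi, hi', (h1 i hlt).trans he, hm⟩
        · refine ⟨j, f', ?_, hge.trans hi', h3, hm.trans (h6 i e hge he)⟩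
          by_contra hc
          have h7 := ht₀ t (by omega) j (by omega)
          have h8 := ht₀ (t + 1) (by omega) j (by omega)
          rw [h2] at h7
          rw [h3] at h8
          exact h5 (Option.some.inj (h8.trans h7.symm) ▸ h4)
  obtain ⟨t₂, ht₂⟩ := hE (A t₁).length
  obtain ⟨i, e, hi, hi', he, hm⟩ := key (max (t₁ + 1) t₂) (le_max_left _ _)
  obtain rfl := Option.some.inj (he.symm.trans (ht₂ _ (le_max_right _ _) i hi'))
  exact ⟨i, hi, hm⟩

end Stacks

/-! ### Interleaving finite runs -/

theorem exists_run_of_reflTransGen {α : Type*} {R : α → α → Prop} {a b : α}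
    (h : Relation.ReflTransGen R a b) :
    ∃ (n : ℕ) (g : ℕ → α), g 0 = a ∧ g n = b ∧ ∀ i < n, R (g i) (g (i + 1)) := by
  induction h with
  | refl => exact ⟨0, fun _ => a, rfl, rfl, by simp⟩
  | @tail b c _ hbc ih =>
    obtain ⟨n, g, h0, hn, hg⟩ := ih
    refine ⟨n + 1, fun i => if i ≤ n then g i else c, by simp [h0], by simp, fun i hi => ?_⟩
    rcases (show i ≤ n by omega).lt_or_eq with hlt | rfl
    · simpa [hlt.le, Nat.succ_le_of_lt hlt] using hg i hlt
    · simpa [hn] using hbc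

/-- Finite runs of steps labelled `1` and single steps labelled `p n`, in alternation, form one
infinite run in which the same labels greater than `1` occur infinitely often. -/
theorem exists_interleaving {α : Type*} {R : α → ℕ → α → Prop} {c d : ℕ → α} {p : ℕ → ℕ}
    (hrun : ∀ n, Relation.ReflTransGen (R · 1 ·) (c n) (d n))
    (hstep : ∀ n, R (d n) (p n) (c (n + 1))) :
    ∃ (b : ℕ → α) (p' : ℕ → ℕ), (∀ t, R (b t) (p' t) (b (t + 1))) ∧
      (∀ t, ∃ n, Relation.ReflTransGen (R · 1 ·) (c n) (b t)) ∧
      ∀ q, 1 < q → ((∃ᶠ t in Filter.atTop, p' t = q) ↔ ∃ᶠ n in Filter.atTop, p n = q) := by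
  choose K g hg0 hgK hg using fun n => exists_run_of_reflTransGen (hrun n)
  -- The state `(n, i)` means position `i` in the `n`-th finite run; from the last position `K n`
  -- the step labelled `p n` leads to the next run.
  let next : ℕ × ℕ → ℕ × ℕ := fun s => if s.2 < K s.1 then (s.1, s.2 + 1) else (s.1 + 1, 0)
  let st : ℕ → ℕ × ℕ := fun t => next^[t] (0, 0)
  have hst : ∀ t, st (t + 1) = next (st t) := fun t => Function.iterate_succ_apply' _ _ _
  have hle : ∀ t, (st t).2 ≤ K (st t).1 := by
    intro t
    induction t with
    | zero => exact Nat.zero_le _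
    | succ t ih =>
      rw [hst]
      by_cases hlt : (st t).2 < K (st t).1
      · simp only [next, if_pos hlt]; omega
      · simp only [next, if_neg hlt]; omega
  have hmono : Monotone fun t => (st t).1 := by
    refine monotone_nat_of_le_succ fun t => ?_
    rw [hst]
    by_cases hlt : (st t).2 < K (st t).1
    · simp only [next, if_pos hlt]; omega
    · simp only [next, if_neg hlt]; omega
  have hreach : ∀ n, ∀ i ≤ K n, ∃ t, n ≤ t ∧ st t = (n, i) := by
    intro n
    induction n with
    | zero =>
      intro i
      induction i with
      | zero => exact fun _ => ⟨0, le_rfl, rfl⟩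
      | succ i ih =>
        intro hi
        obtain ⟨t, ht, h1⟩ := ih (by omega)
        exact ⟨t + 1, by omega, by rw [hst, h1]; exact if_pos (show i < K 0 by omega)⟩
    | succ n ihn =>
      intro i
      induction i with
      | zero =>
        intro _
        obtain ⟨t, ht, h1⟩ := ihn (K n) le_rfl
        exact ⟨t + 1, by omega, by rw [hst, h1]; exact if_neg (lt_irrefl _)⟩
      | succ i ih =>
        intro hi
        obtain ⟨t, ht, h1⟩ := ih (by omega)
        exact ⟨t + 1, by omega, by rw [hst, h1]; exact if_pos (show i < K (n + 1) by omega)⟩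
  refine ⟨fun t => g (st t).1 (st t).2,
    fun t => if (st t).2 < K (st t).1 then 1 else p (st t).1, fun t => ?_, fun t => ?_,
    fun q hq => ⟨fun hf => ?_, fun hf => ?_⟩⟩
  · beta_reduce
    rw [hst]
    by_cases hlt : (st t).2 < K (st t).1
    · simp only [next, if_pos hlt]
      exact hg _ _ hlt
    · simp only [next, if_neg hlt]
      have := hle t
      rw [show (st t).2 = K (st t).1 by omega, hgK, hg0]
      exact hstep _
  · refine ⟨(st t).1, ?_⟩
    have : ∀ i ≤ K (st t).1, Relation.ReflTransGen (R · 1 ·) (c (st t).1) (g (st t).1 i) := by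
      intro i
      induction i with
      | zero => intro _; rw [hg0]
      | succ i ih => exact fun hi => (ih (by omega)).tail (hg _ _ (by omega))
    exact this _ (hle t)
  · refine Filter.frequently_atTop.2 fun n => ?_
    obtain ⟨t₀, -, ht₀⟩ := hreach n 0 (Nat.zero_le _)
    obtain ⟨t, ht, h1⟩ := Filter.frequently_atTop.1 hf t₀
    refine ⟨(st t).1, ?_, ?_⟩
    · have := hmono ht
      simpa only [ht₀] using this
    · beta_reduce at h1
      split_ifs at h1
      · omega
      · exact h1
  · refine Filter.frequently_atTop.2 fun t₀ => ?_
    obtain ⟨n, hn, h1⟩ := Filter.frequently_atTop.1 hf t₀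
    obtain ⟨t, ht, h2⟩ := hreach n (K n) le_rfl
    refine ⟨t, hn.trans ht, ?_⟩
    simpa [h2] using h1

/-! ### Shifting -/

theorem shift_one {r : ℕ} (hr : 1 ≤ r) : shift r 1 = r := by
  have : ¬ r < 1 := by omega
  simp [shift, this]

/-- Hence a declaration after a finite play depends only on its original value and on the greatest
priority passed. -/
theorem shift_shift {r p q : ℕ} (hp : 1 ≤ p) (hq : 1 ≤ q) :
    shift (shift r p) q = shift r (max p q) := by
  rcases le_total p q with h | h
  · rw [max_eq_right h]
    simp only [shift, Nat.odd_iff, Nat.even_iff]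
    split_ifs <;> omega
  · rw [max_eq_left h]
    simp only [shift, Nat.odd_iff, Nat.even_iff]
    split_ifs <;> omega

/-- An odd shifted declaration yields `⊤`: declaring `r` is Eve's promise to see nothing worse for
her than `r` before the variable, and it has been kept. -/
theorem gain_le_of_odd_shift {r q : ℕ} (h : ¬ Even (shift r q)) :
    gain .Eve r ≤ gain .Eve q := by
  simp only [shift, gain, Nat.odd_iff, Nat.even_iff] at *
  split_ifs at * <;> omega

theorem gain_lt_of_even_shift {r q : ℕ} (hr : 1 ≤ r) (hq : 1 ≤ q) (h : Even (shift r q)) :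
    gain .Eve q < gain .Eve r := by
  simp only [shift, gain, Nat.odd_iff, Nat.even_iff] at *
  split_ifs at * <;> omega

/-- Since `2 * d` exceeds every priority, no shift alters it: this declaration promises that the
variable is never reached. -/
theorem even_shift_two_mul {d q : ℕ} (hq : 1 ≤ q) (hqd : q ≤ d) : Even (shift (2 * d) q) := by
  simp only [shift, Nat.odd_iff, Nat.even_iff]
  split_ifs <;> omega

/-! ### Greatest weights in a list -/

section MaxOf

variable {α : Type*}

/-- The greatest value of `f` in a list, and `1` if it is empty. -/
def maxOf (f : α → ℕ) (l : List α) : ℕ := (l.map f).foldr max 1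

variable {f g : α → ℕ} {l : List α}

theorem one_le_maxOf : 1 ≤ maxOf f l := by
  induction l with
  | nil => exact le_rfl
  | cons e l ih => exact le_max_of_le_right ih

theorem le_maxOf {e : α} (h : e ∈ l) : f e ≤ maxOf f l := by
  induction l with
  | nil => simp at h
  | cons a l ih =>
    rcases List.mem_cons.1 h with rfl | h
    · exact le_max_left _ _
    · exact le_max_of_le_right (ih h)

theorem maxOf_eq_one_or : maxOf f l = 1 ∨ ∃ e ∈ l, f e = maxOf f l := by
  induction l with
  | nil => exact Or.inl rfl
  | cons a l ih =>
    rcases le_total (f a) (maxOf f l) with h | h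
    · have h1 : maxOf f (a :: l) = maxOf f l := max_eq_right h
      rw [h1]
      exact ih.imp_right fun ⟨e, he, h⟩ => ⟨e, List.mem_cons_of_mem _ he, h⟩
    · exact Or.inr ⟨a, by simp, (max_eq_left h).symm⟩

theorem maxOf_le {b : ℕ} (hb : 1 ≤ b) (h : ∀ e ∈ l, f e ≤ b) : maxOf f l ≤ b := by
  rcases maxOf_eq_one_or (f := f) (l := l) with h1 | ⟨e, he, h1⟩
  · omega
  · exact h1 ▸ h e he

theorem gain_maxOf {w : Player} (h : ∀ e ∈ l, gain w (f e) ≤ gain w (g e)) :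
    gain w (maxOf f l) ≤ gain w (maxOf g l) := by
  induction l with
  | nil => exact le_rfl
  | cons a l ih =>
    exact gain_max (h a (by simp)) (ih fun e he => h e (List.mem_cons_of_mem _ he))

end MaxOf

/-! ### Playing in the transformed tree -/

section Play

open PTree

variable {V : Type u} [DecidableEq V] {d : ℕ} {w : Player} {ρ : List ℕ → ℕ} {G : PTree}

/-- After the given path only one continuation exists, with constant priority `c`, and it agrees
with every strategy; so the winner is decided by `c`. -/
theorem favourable_of_cpath_const (hstr : G.IsStrategy w ρ)
    (hwin : ∀ ξ : ℕ → ℕ, G.IsBranch ξ → G.Agrees w ρ ξ → G.BranchWonBy w ξ)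
    {C : PTree} {c : ℕ} (hC : C = node (.lab .Eve c) 1 fun _ => C) {r : ℕ} {v : List ℕ}
    (h : CPath w ρ [] G r v C) : Favourable w c := by
  let x : ℕ → List ℕ := fun k => v ++ List.replicate k 0
  have hx : ∀ k, x (k + 1) = x k ++ [0] := fun k => by
    simp only [x, List.append_assoc, List.append_cancel_left_eq]
    exact List.replicate_succ'
  have hsub : ∀ k, G.subtree? (x k) = some C := by
    intro k
    induction k with
    | zero => simpa [x] using (h.spec rfl).2.1
    | succ k ih =>
      rw [hC] at ih
      rw [hx]
      exact subtree?_concat_node ih 0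
  have hstep : ∀ k, CPath w ρ (x k) C c (x (k + 1)) C := by
    intro k
    have h1 : CPath w ρ (x k) (node (.lab .Eve c) 1 fun _ => C) c (x k ++ [((0 : Fin 1) : ℕ)]) C := by
      refine CPath.single (x k) .Eve c 1 (fun _ => C) 0 fun hw => ?_
      have h2 := hstr (x k) C (hsub k) ⟨c, by rw [hC, label_node, hw]⟩ (by rw [hC, arity_node])
      rw [hC, arity_node] at h2
      exact (Nat.lt_one_iff.1 h2).symm
    rw [← hC] at h1
    rw [hx]
    exact h1
  -- The path into `C` is the first block, followed by infinitely many single steps.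
  obtain ⟨R, hR, h1, h2⟩ := favourable_of_cpaths (G := G) hwin
    (v := fun k => Nat.casesOn k [] x) (S := fun k => Nat.casesOn k G fun _ => C)
    (r := fun k => Nat.casesOn k r fun _ => c) (b := max r c)
    (fun k => by cases k <;> simp) rfl rfl
    (fun k => by
      cases k with
      | zero => simpa [x] using h
      | succ k => exact hstep k)
  have h3 : R ≤ c := by
    obtain ⟨k, hk, h⟩ := Filter.frequently_atTop.1 h1 1
    obtain ⟨k, rfl⟩ := Nat.exists_eq_add_of_le' hk
    exact h
  have h4 : c ≤ R := by
    obtain ⟨k, hk⟩ := Filter.eventually_atTop.1 h2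
    exact hk (k + 1) (by omega)
  rwa [le_antisymm h4 h3]

/-- A variable reached in a play that agrees with a winning strategy has a declaration of the parity
that suits the player. -/
theorem not_favourable_of_cpath_var (hstr : G.IsStrategy w ρ)
    (hwin : ∀ ξ : ℕ → ℕ, G.IsBranch ξ → G.Agrees w ρ ξ → G.BranchWonBy w ξ)
    {Z : V → Option ℕ} {z : V} {r n : ℕ} {v : List ℕ}
    (h : CPath w ρ [] G r v (tr d Z (.var z))) (hn : Z z = some n) : ¬ Favourable w n := by
  cases w with
  | Eve =>
    intro hf
    rw [tr_var_even d Z z n hn hf] at h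
    have := favourable_of_cpath_const hstr hwin botTree_eq h
    simp [Favourable] at this
  | Adam =>
    intro hf
    rw [tr_var_odd d Z z n hn hf] at h
    have := favourable_of_cpath_const hstr hwin topTree_eq h
    exact absurd this (by simp only [Favourable]; decide)

/-- At an explicit substitution, in a play that agrees with a strategy, there is a declaration `r`
such that the play may continue to the left tree with this declaration, and for every priority `q` by
which `r` may be shifted to the parity suiting the player, it may continue to the right tree,
visiting a priority not better than `q`. -/
theorem exists_declaration (hd : 1 ≤ d) (hstr : G.IsStrategy w ρ) {Z : V → Option ℕ}
    {T U : ExtTree V} {z : V} {v : List ℕ}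
    (hv : G.subtree? v = some (tr d Z (.sub T U z))) :
    ∃ r, 1 ≤ r ∧
      (∃ u, CPath w ρ v (tr d Z (.sub T U z)) 1 u (tr d (Function.update Z z (some r)) T)) ∧
      ∀ q, 1 ≤ q → q ≤ d → ¬ Favourable w (shift r q) →
        ∃ r' u, 1 ≤ r' ∧ r' ≤ d ∧ gain w r' ≤ gain w q ∧
          CPath w ρ v (tr d Z (.sub T U z)) r' u (tr d (shiftAll Z r') U) := by
  let J : ℕ → PTree := fun i => node (.lab .Eve (i + 1)) 1 fun _ => tr d (shiftAll Z (i + 1)) U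
  let D : ℕ → PTree := fun i => node (.lab .Adam 1) 2
    ![tr d (Function.update Z z (some (i + 1))) T, J i]
  have hsub : tr d Z (.sub T U z) = node (.lab .Eve 1) (d + 1) fun i =>
      if (i : ℕ) < d then D i else tr d (Function.update Z z (some (2 * d))) T := tr_sub d Z T U z
  rw [hsub] at hv
  have hvd : w = .Eve → ρ v < d + 1 := fun hw => by
    have := hstr v _ hv ⟨1, by rw [label_node, hw]⟩ (by simp)
    simpa using this
  have hD : ∀ i, i < d → G.subtree? (v ++ [i]) = some (D i) := fun i hi => by
    have := subtree?_concat_node hv ⟨i, by omega⟩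
    simpa [hi] using this
  have hDd : ∀ i, i < d → w = .Adam → ρ (v ++ [i]) < 2 := fun i hi hw => by
    have := hstr _ _ (hD i hi) ⟨1, by rw [label_node, hw]⟩ (by simp [D])
    simpa [D] using this
  have hJ : ∀ i, i < d → G.subtree? (v ++ [i] ++ [1]) = some (J i) := fun i hi =>
    subtree?_concat_node (hD i hi) 1
  have hJd : ∀ i, i < d → w = .Eve → ρ (v ++ [i] ++ [1]) = 0 := fun i hi hw => by
    have := hstr _ _ (hJ i hi) ⟨i + 1, by rw [label_node, hw]⟩ (by simp [J])
    simpa [J] using this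
  have p1 : ∀ i, i < d → (w = .Eve → i = ρ v) →
      CPath w ρ v (tr d Z (.sub T U z)) 1 (v ++ [i]) (D i) := fun i hi hw => by
    have := CPath.single (w := w) (ρ := ρ) v .Eve 1 (d + 1) (fun i : Fin (d + 1) =>
      if (i : ℕ) < d then D i else tr d (Function.update Z z (some (2 * d))) T) ⟨i, by omega⟩
      (fun h => hw h.symm)
    rw [hsub]
    simpa [hi] using this
  have p1' : (w = .Eve → d = ρ v) → CPath w ρ v (tr d Z (.sub T U z)) 1 (v ++ [d])
      (tr d (Function.update Z z (some (2 * d))) T) := fun hw => by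
    have := CPath.single (w := w) (ρ := ρ) v .Eve 1 (d + 1) (fun i : Fin (d + 1) =>
      if (i : ℕ) < d then D i else tr d (Function.update Z z (some (2 * d))) T) ⟨d, by omega⟩
      (fun h => hw h.symm)
    rw [hsub]
    simpa using this
  have p2 : ∀ i, i < d → (w = .Eve → i = ρ v) → (w = .Adam → 0 = ρ (v ++ [i])) →
      CPath w ρ v (tr d Z (.sub T U z)) 1 (v ++ [i] ++ [0])
        (tr d (Function.update Z z (some (i + 1))) T) := fun i hi hw hw' =>
    (p1 i hi hw).trans (CPath.single (w := w) (ρ := ρ) (v ++ [i]) .Adam 1 2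
      ![tr d (Function.update Z z (some (i + 1))) T, J i] 0 fun h => hw' h.symm)
  have p3 : ∀ i, i < d → (w = .Eve → i = ρ v) → (w = .Adam → 1 = ρ (v ++ [i])) →
      CPath w ρ v (tr d Z (.sub T U z)) (i + 1) (v ++ [i] ++ [1] ++ [0])
        (tr d (shiftAll Z (i + 1)) U) := fun i hi hw hw' => by
    have h1 := (p1 i hi hw).trans (CPath.single (w := w) (ρ := ρ) (v ++ [i]) .Adam 1 2
      ![tr d (Function.update Z z (some (i + 1))) T, J i] 1 fun h => hw' h.symm)
    have h2 := h1.trans (CPath.single (w := w) (ρ := ρ) (v ++ [i] ++ [1]) .Eve (i + 1) 1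
      (fun _ => tr d (shiftAll Z (i + 1)) U) 0 fun h => (hJd i hi h.symm).symm)
    simpa using h2
  cases w with
  | Eve =>
    -- Eve's strategy names the declaration. If it is at most `d`, Adam may choose either child, so
    -- both continuations agree with `ρ`; if it is `2 * d`, no shift has the parity suiting her and
    -- no jump is demanded.
    rcases (Nat.lt_succ_iff.1 (hvd rfl)).lt_or_eq with hlt | heq
    · refine ⟨ρ v + 1, by omega, ⟨_, p2 _ hlt (fun _ => rfl) nofun⟩, fun q hq hqd hf => ?_⟩
      exact ⟨ρ v + 1, _, by omega, by omega, gain_le_of_odd_shift hf,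
        p3 _ hlt (fun _ => rfl) nofun⟩
    · exact ⟨2 * d, by omega, ⟨_, p1' fun _ => heq.symm⟩, fun q hq hqd hf =>
        absurd (even_shift_two_mul hq hqd) hf⟩
  | Adam =>
    have jump : ∀ q, 1 ≤ q → q ≤ d → ρ (v ++ [q - 1]) ≠ 0 →
        ∃ r' u, 1 ≤ r' ∧ r' ≤ d ∧ gain .Adam r' ≤ gain .Adam q ∧
          CPath .Adam ρ v (tr d Z (.sub T U z)) r' u (tr d (shiftAll Z r') U) := by
      intro q hq hqd h
      obtain ⟨i, rfl⟩ := Nat.exists_eq_add_of_le' hq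
      have h1 := hDd i (by omega) rfl
      rw [Nat.add_sub_cancel] at h
      exact ⟨i + 1, _, hq, hqd, le_rfl, p3 i (by omega) nofun fun _ => by omega⟩
    -- When `ρ` is Adam's, Eve's choice is free. `S` collects the declarations, lowered by one, at
    -- which Adam enters the left tree. If there are none, the last child is taken and Adam jumps at
    -- every `q`. Otherwise the declaration worst for Eve is taken: a `q` shifting it to an even
    -- value is still worse for Eve, hence outside `S`, so Adam jumps at `q`.
    let S := (Finset.range d).filter fun i => ρ (v ++ [i]) = 0
    rcases S.eq_empty_or_nonempty with hS | hS
    · refine ⟨2 * d, by omega, ⟨_, p1' nofun⟩, fun q hq hqd _ => jump q hq hqd fun h => ?_⟩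
      have : q - 1 ∈ S := Finset.mem_filter.2 ⟨Finset.mem_range.2 (by omega), h⟩
      simp [hS] at this
    · obtain ⟨i, hi, hmin⟩ := S.exists_min_image (fun i => gain .Eve (i + 1)) hS
      obtain ⟨hid, hi0⟩ := Finset.mem_filter.1 hi
      rw [Finset.mem_range] at hid
      refine ⟨i + 1, by omega, ⟨_, p2 i hid nofun fun _ => hi0.symm⟩, fun q hq hqd hf =>
        jump q hq hqd fun h => ?_⟩
      have h1 := hmin (q - 1) (Finset.mem_filter.2 ⟨Finset.mem_range.2 (by omega), h⟩)
      rw [Nat.sub_add_cancel hq] at h1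
      have h2 := gain_lt_of_even_shift (Nat.succ_pos i) hq (Nat.not_odd_iff_even.1 hf)
      exact absurd h1 (not_le.2 h2)

end Play

/-! ### Simulating the game on the expansion by the game on the transformed tree -/

/-- Compares the substitutions already entered by the simulation with those visible to the
simplification; the surplus `l₁` has still to be entered. -/
theorem ExtTree.eq_subs_of_subs_eq {V : Type u} {S S' : ExtTree V} (hS : ∀ T U z, S ≠ .sub T U z)
    (l : List (V × ExtTree V)) : ∀ l', subs S' l = subs S l' →
      ∃ l₁, l' = l₁ ++ l ∧ S' = subs S l₁ := by
  induction l using List.reverseRecOn with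
  | nil => exact fun l' h => ⟨l', by simp, h⟩
  | append_singleton l q ih =>
    intro l' h
    rcases List.eq_nil_or_concat' l' with rfl | ⟨m, q', rfl⟩
    · rw [subs_concat] at h
      exact absurd h.symm (hS _ _ _)
    · rw [subs_concat, subs_concat] at h
      obtain ⟨h1, h2, h3⟩ := sub_inj h
      obtain ⟨l₁, rfl, h4⟩ := ih m h1
      exact ⟨l₁, by rw [List.append_assoc, Prod.ext h3 h2], h4⟩

/-- A node of a transformed tree at which an extended tree is transformed. -/
structure Pos (V : Type u) where
  path : List ℕ
  decls : V → Option ℕ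
  tree : ExtTree V

/-- A part of a play in a transformed tree, leading to the position `target`. The greatest priority
on it is `prio`, and it stands for a part of a play in the expansion with greatest priority
`weight`. If the part enters the left tree of an explicit substitution `T[U/z]` with declaration `r`,
then `pushed` is `(z, U, r)`. -/
structure Entry (V : Type u) where
  target : Pos V
  prio : ℕ
  weight : ℕ
  pushed : Option (V × ExtTree V × ℕ)

section Simulation

open PTree

variable {V : Type u}

/-- The entry enters the left tree of an explicit substitution. -/
def Entry.IsOpen (e : Entry V) : Prop := e.pushed.isSome

/-- The position reached in a play in the transformation of `T`. -/
def current (T : ExtTree V) : List (Entry V) → Pos V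
  | [] => ⟨[], noDecl, T⟩
  | e :: _ => e.target

/-- The explicit substitutions under which the current extended tree stands. -/
def pending (A : List (Entry V)) : List (V × ExtTree V) :=
  A.filterMap fun e => e.pushed.map fun q => (q.1, q.2.1)

variable [DecidableEq V]

/-- The subtree at a position of a transformed tree. -/
def Pos.subtree (d : ℕ) (x : Pos V) : PTree := tr d x.decls x.tree

variable (d : ℕ) (w : Player) (ρ : List ℕ → ℕ)

/-- The entry `e` may follow the position `x` in a play that agrees with `ρ`. -/
structure Entry.Follows (x : Pos V) (e : Entry V) : Prop where
  cpath : CPath w ρ x.path (x.subtree d) e.prio e.target.path (e.target.subtree d)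
  one_le_prio : 1 ≤ e.prio
  prio_le : e.prio ≤ d
  one_le_weight : 1 ≤ e.weight
  weight_le : e.weight ≤ d
  gain_le : gain w e.prio ≤ gain w e.weight
  decls_of_none : e.pushed = none → e.target.decls = shiftAll x.decls e.prio
  of_some : ∀ z U r, e.pushed = some (z, U, r) → e.prio = 1 ∧ e.weight = 1 ∧ 1 ≤ r ∧
    e.target.decls = Function.update x.decls z (some r) ∧
    ∀ q, 1 ≤ q → q ≤ d → ¬ Favourable w (shift r q) → ∃ r' u, 1 ≤ r' ∧ r' ≤ d ∧
      gain w r' ≤ gain w q ∧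
      CPath w ρ x.path (x.subtree d) r' u (tr d (shiftAll x.decls r') U)

variable (T : ExtTree V)

/-- The entries form a play in the transformation of `T` that agrees with `ρ`. -/
def IsPlay : List (Entry V) → Prop
  | [] => True
  | e :: A => IsPlay A ∧ e.Follows d w ρ (current T A)

/-- One step of the simulation. -/
def SimStep (A : List (Entry V)) (p : ℕ) (A' : List (Entry V)) : Prop :=
  StackStep Entry.IsOpen Entry.weight A p A' ∧ IsPlay d w ρ T A'

variable {d w ρ T}

theorem IsPlay.of_append {B C : List (Entry V)} (h : IsPlay d w ρ T (B ++ C)) :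
    IsPlay d w ρ T C := by
  induction B with
  | nil => exact h
  | cons e B ih => exact ih h.1

theorem IsPlay.exists_follows {A : List (Entry V)} (h : IsPlay d w ρ T A) {e : Entry V}
    (he : e ∈ A) : ∃ x, e.Follows d w ρ x := by
  obtain ⟨B, C, rfl⟩ := List.append_of_mem he
  exact ⟨_, h.of_append.2⟩

theorem IsPlay.exists_cpath {A : List (Entry V)} (h : IsPlay d w ρ T A) (hA : A ≠ []) :
    ∃ r, CPath w ρ [] (tr d noDecl T) r (current T A).path ((current T A).subtree d) := by
  induction A with
  | nil => exact absurd rfl hA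
  | cons e A ih =>
    rcases A with _ | ⟨f, A⟩
    · exact ⟨_, h.2.cpath⟩
    · obtain ⟨r, hr⟩ := ih h.1 (by simp)
      exact ⟨_, hr.trans h.2.cpath⟩

theorem IsPlay.subtree?_eq {A : List (Entry V)} (h : IsPlay d w ρ T A) :
    (tr d noDecl T).subtree? (current T A).path = some ((current T A).subtree d) := by
  rcases A with _ | ⟨f, A⟩
  · rfl
  · obtain ⟨r, hr⟩ := h.exists_cpath (by simp)
    exact (hr.spec rfl).2.1

/-- Closed entries in `B` shift by their priority, and such shifts combine to one by the maximum.
Open ones have priority `1` and declare other variables, so they change neither side. -/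
theorem IsPlay.decls_eq {B : List (Entry V)} {e : Entry V} {C : List (Entry V)}
    (h : IsPlay d w ρ T (B ++ e :: C)) {z : V} {U : ExtTree V} {r : ℕ}
    (he : e.pushed = some (z, U, r)) (hB : ∀ q ∈ pending B, q.1 ≠ z) :
    (current T (B ++ e :: C)).decls z = some (shift r (maxOf Entry.prio B)) := by
  induction B with
  | nil =>
    obtain ⟨-, -, h1, h2, -⟩ := h.2.of_some _ _ _ he
    show e.target.decls z = some (shift r 1)
    rw [h2, Function.update_self, shift_one h1]
  | cons f B ih =>
    have h1 := ih h.1 fun q hq => hB q (by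
      obtain ⟨g, hg, hg'⟩ := List.mem_filterMap.1 hq
      exact List.mem_filterMap.2 ⟨g, List.mem_cons_of_mem _ hg, hg'⟩)
    have h2 : Entry.Follows d w ρ (current T (B ++ e :: C)) f := h.2
    show f.target.decls z = some (shift r (max f.prio (maxOf Entry.prio B)))
    rcases hf : f.pushed with _ | ⟨z', U', r'⟩
    · rw [h2.decls_of_none hf, shiftAll, h1, Option.map_some,
        shift_shift one_le_maxOf h2.one_le_prio, max_comm]
    · obtain ⟨h3, -, -, h4, -⟩ := h2.of_some _ _ _ hf
      have hne : z' ≠ z := hB (z', U') (List.mem_filterMap.2 ⟨f, by simp, by simp [hf]⟩)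
      rw [h4, Function.update_of_ne hne.symm, h1, h3, max_eq_right one_le_maxOf]

theorem exists_simStep_sub (hd : 1 ≤ d) (hstr : (tr d noDecl T).IsStrategy w ρ)
    {A : List (Entry V)} (h : IsPlay d w ρ T A) {S U : ExtTree V} {z : V}
    (ht : (current T A).tree = .sub S U z) :
    ∃ A', SimStep d w ρ T A 1 A' ∧ (current T A').tree = S ∧
      pending A' = (z, U) :: pending A := by
  have h1 := h.subtree?_eq
  have h0 : (current T A).subtree d = tr d (current T A).decls (.sub S U z) := by
    rw [Pos.subtree, ht]
  rw [h0] at h1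
  obtain ⟨r, hr, ⟨u, hu⟩, hjump⟩ := exists_declaration hd hstr h1
  refine ⟨⟨⟨u, Function.update (current T A).decls z (some r), S⟩, 1, 1, some (z, U, r)⟩ :: A,
    ⟨StackStep.push A _ 1 rfl, h, ?_⟩, rfl, rfl⟩
  refine ⟨by rw [h0]; exact hu, le_rfl, hd, le_rfl, hd, le_rfl, nofun, fun z' U' r' he => ?_⟩
  simp only [Option.some.injEq, Prod.mk.injEq] at he
  obtain ⟨rfl, rfl, rfl⟩ := he
  exact ⟨rfl, rfl, hr, rfl, by rw [h0]; exact hjump⟩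

/-- The retraction: everything since the substitution for `z` was entered is replaced by a single
closed entry that jumps to `U`. -/
theorem exists_simStep_var (hd : 1 ≤ d) (hstr : (tr d noDecl T).IsStrategy w ρ)
    (hwin : ∀ ξ : ℕ → ℕ, (tr d noDecl T).IsBranch ξ → (tr d noDecl T).Agrees w ρ ξ →
      (tr d noDecl T).BranchWonBy w ξ)
    {A : List (Entry V)} (h : IsPlay d w ρ T A) {z : V} (ht : (current T A).tree = .var z)
    {U : ExtTree V} {l₁ l₂ : List (V × ExtTree V)} (hA : pending A = l₁ ++ (z, U) :: l₂)
    (hl : ∀ q ∈ l₁, q.1 ≠ z) :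
    ∃ A', SimStep d w ρ T A 1 A' ∧ (current T A').tree = U ∧ pending A' = l₂ := by
  obtain ⟨B, C, e, r, rfl, hB, hC, he⟩ : ∃ B C e r, A = B ++ e :: C ∧ pending B = l₁ ∧
      pending C = l₂ ∧ e.pushed = some (z, U, r) := by
    obtain ⟨B, D, rfl, hB, hD⟩ := List.filterMap_eq_append_iff.1 hA
    obtain ⟨B', e, C, rfl, hB', he, hC⟩ := List.filterMap_eq_cons_iff.1 hD
    simp only [Option.map_eq_some_iff, Prod.mk.injEq, Prod.exists] at he
    obtain ⟨z', U', r, he, rfl, rfl⟩ := he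
    refine ⟨B ++ B', C, e, r, by simp, ?_, hC, he⟩
    rw [pending, List.filterMap_append, hB, List.filterMap_eq_nil_iff.2 hB', List.append_nil]
  subst hB hC
  obtain ⟨r₀, hr₀⟩ := h.exists_cpath (by simp)
  rw [Pos.subtree, ht] at hr₀
  have hfav := not_favourable_of_cpath_var hstr hwin hr₀ (h.decls_eq he hl)
  have hB : ∀ f ∈ B, ∃ x, f.Follows d w ρ x := fun f hf => h.exists_follows (by simp [hf])
  have heC := h.of_append.2
  have hCp := h.of_append.1
  obtain ⟨-, he1, -, -, hjump⟩ := heC.of_some _ _ _ he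
  -- The reserved jump is used for the greatest priority passed since `e`. The new entry has
  -- priority `r'` but inherits the greatest weight of `B`, so that no priority of the expansion is
  -- lost.
  obtain ⟨r', u, hr1, hrd, hgain, hpath⟩ := hjump (maxOf Entry.prio B) one_le_maxOf
    (maxOf_le hd fun f hf => (hB f hf).choose_spec.prio_le) hfav
  have hgain' : gain w (maxOf Entry.prio B) ≤ gain w (maxOf Entry.weight B) :=
    gain_maxOf fun f hf => (hB f hf).choose_spec.gain_le
  refine ⟨⟨⟨u, shiftAll (current T C).decls r', U⟩, r', maxOf Entry.weight B, none⟩ :: C,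
    ⟨StackStep.merge B e C _ (by simp [Entry.IsOpen, he]) (by simp [Entry.IsOpen]) ?_ ?_, hCp, ?_⟩,
    rfl, rfl⟩
  · intro f hf
    rcases List.mem_append.1 hf with hf | hf
    · exact le_maxOf hf
    · rw [List.mem_singleton.1 hf, he1]
      exact one_le_maxOf
  · exact maxOf_eq_one_or.imp_right fun ⟨f, hf, h⟩ => ⟨f, List.mem_append_left _ hf, h⟩
  · exact ⟨hpath, hr1, hrd, one_le_maxOf,
      maxOf_le hd fun f hf => (hB f hf).choose_spec.weight_le, hgain.trans hgain', fun _ => rfl,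
      nofun⟩

/-- The outermost substitution is the last one in `l` and is entered first, hence the induction from
the end of the list. -/
theorem exists_simSteps_subs (hd : 1 ≤ d) (hstr : (tr d noDecl T).IsStrategy w ρ) (S : ExtTree V)
    (l : List (V × ExtTree V)) : ∀ {A : List (Entry V)}, IsPlay d w ρ T A →
      (current T A).tree = .subs S l →
      ∃ A', Relation.ReflTransGen (SimStep d w ρ T · 1 ·) A A' ∧ IsPlay d w ρ T A' ∧
        (current T A').tree = S ∧ pending A' = l ++ pending A := by
  induction l using List.reverseRecOn with
  | nil => exact fun {A} hA ht => ⟨A, .refl, hA, ht, rfl⟩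
  | append_singleton l q ih =>
    intro A hA ht
    rw [ExtTree.subs_concat] at ht
    obtain ⟨A₁, h1, h2, h3⟩ := exists_simStep_sub hd hstr hA ht
    obtain ⟨A₂, h4, h5, h6, h7⟩ := ih h1.2 h2
    exact ⟨A₂, .head h1 h4, h5, h6, by rw [h7, h3]; simp⟩

/-- The simulation follows the simplification of an extended tree. -/
theorem exists_simSteps_of_simpTo (hd : 1 ≤ d) (hstr : (tr d noDecl T).IsStrategy w ρ)
    (hwin : ∀ ξ : ℕ → ℕ, (tr d noDecl T).IsBranch ξ → (tr d noDecl T).Agrees w ρ ξ →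
      (tr d noDecl T).BranchWonBy w ξ)
    {X : ExtTree V} {a : Symb} {k : ℕ} {ts : Fin k → ExtTree V} (hX : X.SimpTo a k ts) :
    ∀ {A : List (Entry V)}, IsPlay d w ρ T A → X = .subs (current T A).tree (pending A) →
      ∃ A', Relation.ReflTransGen (SimStep d w ρ T · 1 ·) A A' ∧ IsPlay d w ρ T A' ∧
        ∃ ts', (current T A').tree = .node a k ts' ∧ ∀ i, ts i = .subs (ts' i) (pending A') := by
  have hnode : ∀ {b : Symb} {j : ℕ} {us : Fin j → ExtTree V} {l : List (V × ExtTree V)}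
      {A : List (Entry V)}, IsPlay d w ρ T A →
      .subs (.node b j us) l = ExtTree.subs (current T A).tree (pending A) →
      ∃ A', Relation.ReflTransGen (SimStep d w ρ T · 1 ·) A A' ∧ IsPlay d w ρ T A' ∧
        (current T A').tree = .node b j us ∧ pending A' = l := by
    intro b j us l A hA h
    obtain ⟨l₁, rfl, h1⟩ := ExtTree.eq_subs_of_subs_eq (ExtTree.node_ne_sub b j us) _ _ h.symm
    exact exists_simSteps_subs hd hstr _ l₁ hA h1
  rw [ExtTree.SimpTo] at hX
  induction hX using Relation.ReflTransGen.head_induction_on with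
  | refl =>
    intro A hA h
    obtain ⟨A', h1, h2, h3, h4⟩ := hnode (l := []) hA h
    exact ⟨A', h1, h2, ts, h3, fun i => by rw [h4]; rfl⟩
  | head hs hr ih =>
    intro A hA h
    cases hs with
    | node b j us l =>
      obtain ⟨A', h1, h2, h3, h4⟩ := hnode hA h
      -- A node simplifies only to itself, so the remaining simplification changes nothing. The
      -- substitutions distributed over the children are those pending on the stack.
      have h5 := ExtTree.node_inj (ExtTree.simpTo_unique
        (T := .node b j fun i => (us i).subs l) .refl hr)
      simp only [Sigma.mk.injEq, Prod.mk.injEq] at h5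
      obtain ⟨⟨rfl, rfl⟩, h5⟩ := h5
      obtain rfl := eq_of_heq h5
      exact ⟨A', h1, h2, us, h3, fun i => by rw [h4]⟩
    | var z U l₁ l₂ hl =>
      obtain ⟨l₀, h1, h2⟩ := ExtTree.eq_subs_of_subs_eq (ExtTree.var_ne_sub z) _ _ h.symm
      obtain ⟨A₁, h3, h4, h5, h6⟩ := exists_simSteps_subs hd hstr _ l₀ hA h2
      rw [← h1] at h6
      obtain ⟨A₂, h7, h8, h9⟩ := exists_simStep_var hd hstr hwin h4 h5 h6 hl
      obtain ⟨A₃, h10, h11⟩ := ih h7.2 (by rw [h8, h9])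
      exact ⟨A₃, h3.trans (.head h7 h10), h11⟩

end Simulation

/-! ### Transferring strategies -/

section Transfer

open PTree

variable {V : Type u} [DecidableEq V] (d : ℕ) (w : Player) (ρ : List ℕ → ℕ) (T : ExtTree V)

/-- The extended tree that a play of the simulation has reached. -/
def reached (A : List (Entry V)) : ExtTree V := .subs (current T A).tree (pending A)

/-- `A'` prolongs `A` to a node with the same expansion as the extended tree reached in `A`. -/
def Settles (A A' : List (Entry V)) : Prop :=
  Relation.ReflTransGen (SimStep d w ρ T · 1 ·) A A' ∧ IsPlay d w ρ T A' ∧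
    ∃ a k ts, (current T A').tree = .node a k ts ∧
      (reached T A).expansion = node a k fun i => (ExtTree.subs (ts i) (pending A')).expansion

/-- `A'` prolongs `A`, which has reached a node, by a move to the child `i`. -/
def Moves (A : List (Entry V)) (i : ℕ) (A' : List (Entry V)) : Prop :=
  ∃ o p k ts, ∃ hi : i < k, (current T A).tree = .node (.lab o p) k ts ∧
    A' = ⟨⟨(current T A).path ++ [i], shiftAll (current T A).decls p, ts ⟨i, hi⟩⟩, p, p, none⟩ :: A

/-- The play prolonged to a node. -/
noncomputable def settle (A : List (Entry V)) : List (Entry V) :=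
  Classical.epsilon (Settles d w ρ T A)

/-- The play of the simulation that belongs to a node of the expansion. -/
noncomputable def simulate (v : List ℕ) : List (Entry V) :=
  v.foldl (fun A i => Classical.epsilon (Moves T (settle d w ρ T A) i)) []

open Classical in
/-- The strategy in the expansion that belongs to the strategy `ρ` in the transformed tree. -/
noncomputable def transfer (v : List ℕ) : ℕ :=
  if ∃ S, T.expansion.subtree? v = some S ∧
      ρ (current T (settle d w ρ T (simulate d w ρ T v))).path < S.arity then
    ρ (current T (settle d w ρ T (simulate d w ρ T v))).path
  else 0

variable {d w ρ T}

/-- The guard and the default `0` in `transfer` give legality at every node, even at those not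
reached by the simulation. -/
theorem isStrategy_transfer : T.expansion.IsStrategy w (transfer d w ρ T) := by
  intro v S hS _ hk
  unfold transfer
  split_ifs with h
  · obtain ⟨S', hS', h⟩ := h
    obtain rfl := Option.some.inj (hS.symm.trans hS')
    exact h
  · exact hk

/-! ### The limit of a simulation and its winner -/

theorem exists_append_of_entryAt {α : Type*} {A : List α} {i : ℕ} {e : α}
    (h : entryAt A i = some e) : ∃ B C, A = B ++ e :: C ∧ C.length = i := by
  induction A with
  | nil => simp [entryAt] at h
  | cons f A ih =>
    have hi := lt_length_of_entryAt h
    rcases (Nat.lt_succ_iff.1 hi).lt_or_eq with hlt | rfl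
    · rw [entryAt_cons _ _ hlt] at h
      obtain ⟨B, C, rfl, hC⟩ := ih h
      exact ⟨f :: B, C, rfl, hC⟩
    · rw [entryAt_cons_length] at h
      exact ⟨[], A, by rw [Option.some.inj h]; rfl, rfl⟩

theorem IsPlay.follows_zero {A : List (Entry V)} (hA : IsPlay d w ρ T A) {e : Entry V}
    (h : entryAt A 0 = some e) : e.Follows d w ρ (current T []) := by
  obtain ⟨B, C, rfl, hC⟩ := exists_append_of_entryAt h
  obtain rfl := List.length_eq_zero_iff.1 hC
  exact hA.of_append.2

theorem IsPlay.follows_succ {A : List (Entry V)} (hA : IsPlay d w ρ T A) {i : ℕ} {e f : Entry V}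
    (he : entryAt A i = some e) (hf : entryAt A (i + 1) = some f) :
    f.Follows d w ρ e.target := by
  obtain ⟨B, C, rfl, hC⟩ := exists_append_of_entryAt hf
  rcases C with _ | ⟨g, C⟩
  · simp at hC
  · have h := hA.of_append.2
    simp only [List.length_cons, Nat.add_right_cancel_iff] at hC
    subst hC
    rw [entryAt_append _ _ (by simp), entryAt_cons _ _ (by simp), entryAt_cons_length] at he
    rwa [← Option.some.inj he]

/-- The limit superior of the labels in an infinite run of the simulation is favourable. -/
theorem favourable_of_simSteps
    (hwin : ∀ ξ : ℕ → ℕ, (tr d noDecl T).IsBranch ξ → (tr d noDecl T).Agrees w ρ ξ →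
      (tr d noDecl T).BranchWonBy w ξ)
    {A : ℕ → List (Entry V)} {p : ℕ → ℕ} (hplay : ∀ t, IsPlay d w ρ T (A t))
    (h : ∀ t, StackStep Entry.IsOpen Entry.weight (A t) (p t) (A (t + 1))) :
    ∃ P, 1 ≤ P ∧ Favourable w P ∧ (1 < P → ∃ᶠ t in Filter.atTop, p t = P) ∧
      ∀ q, 1 < q → (∃ᶠ t in Filter.atTop, p t = q) → q ≤ P := by
  obtain ⟨E, hE⟩ := exists_limit_of_stackSteps h
  let y : ℕ → Pos V := fun k => Nat.casesOn k (current T []) fun k => (E k).target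
  have hy : ∀ k, (E k).Follows d w ρ (y k) := by
    intro k
    obtain ⟨t, ht⟩ := hE k
    cases k with
    | zero => exact (hplay t).follows_zero (ht t le_rfl 0 le_rfl)
    | succ k => exact (hplay t).follows_succ (ht t le_rfl k (by omega)) (ht t le_rfl _ le_rfl)
  obtain ⟨R, hR, hR1, hR2⟩ := favourable_of_cpaths (G := tr d noDecl T) hwin
    (v := fun k => (y k).path) (S := fun k => (y k).subtree d) (r := fun k => (E k).prio) (b := d)
    (fun k => (hy k).prio_le) rfl rfl (fun k => (hy k).cpath)
  obtain ⟨P, hP, hPmax⟩ := exists_isGreatest_frequently (f := fun k => (E k).weight) (b := d)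
    fun k => (hy k).weight_le
  have hle : ∀ᶠ k in Filter.atTop, (E k).weight ≤ P :=
    eventually_le_of_frequently_eq (fun k => (hy k).weight_le) fun q hq => hPmax hq
  have h1P : 1 ≤ P := by
    obtain ⟨k, hk⟩ := Filter.Frequently.exists hP
    exact hk ▸ (hy k).one_le_weight
  refine ⟨P, h1P, ?_, fun h1 => frequently_of_frequently_limit h hE h1 hP, fun q hq hf => ?_⟩
  -- If `P` is unfavourable, an entry of priority `R` has a favourable weight between `R` and `P`,
  -- and an entry of weight `P` has an unfavourable priority between `P` and `R`. Hence `P = R`,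
  -- which is favourable.
  · by_contra hc
    obtain ⟨k, hk, hk1, hk2⟩ := (hR1.and_eventually (hR2.and hle)).exists
    have hkR : (E k).prio = R := le_antisymm hk1 hk
    have h1 := favourable_of_gain (hy k).one_le_prio (hy k).gain_le (hkR ▸ hR)
    obtain ⟨l, hl, hl1⟩ := (Filter.Frequently.and_eventually hP hR2).exists
    have h2 := le_of_gain (hy l).one_le_weight (hy l).gain_le (by rw [hl]; exact hc)
    have : P = R := by omega
    exact hc (this ▸ hR)
  · obtain ⟨k, hk1, hk2⟩ := ((frequently_limit_of_frequently h hE hq hf).and_eventually hle).exists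
    exact hk1.trans hk2

/-- Along the branch, the subtree reached is always the expansion of the extended tree reached by
the simulation. All finite phases together form one infinite run of stacks. -/
theorem branchWonBy_of_agrees_transfer (hd : 1 ≤ d) (hT : T.expansion.IsParityTree d)
    (hstr : (tr d noDecl T).IsStrategy w ρ)
    (hwin : ∀ ξ : ℕ → ℕ, (tr d noDecl T).IsBranch ξ → (tr d noDecl T).Agrees w ρ ξ →
      (tr d noDecl T).BranchWonBy w ξ)
    {ξ : ℕ → ℕ} (hξ : T.expansion.IsBranch ξ) (hag : T.expansion.Agrees w (transfer d w ρ T) ξ) :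
    T.expansion.BranchWonBy w ξ := by
  let c : ℕ → List (Entry V) := fun n => simulate d w ρ T (pathNode ξ n)
  have hpath : ∀ n, pathNode ξ (n + 1) = pathNode ξ n ++ [ξ n] := fun n => by
    simp [pathNode, List.range_succ]
  have hc : ∀ n, c (n + 1) = Classical.epsilon (Moves T (settle d w ρ T (c n)) (ξ n)) := fun n => by
    simp only [c, hpath, simulate, List.foldl_append, List.foldl_cons, List.foldl_nil]
  have step : ∀ n, IsPlay d w ρ T (c n) →
      T.expansion.subtree? (pathNode ξ n) = some (reached T (c n)).expansion →
      ∃ p, 1 ≤ p ∧ p ≤ d ∧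
        Relation.ReflTransGen (SimStep d w ρ T · 1 ·) (c n) (settle d w ρ T (c n)) ∧
        SimStep d w ρ T (settle d w ρ T (c n)) p (c (n + 1)) ∧
        (∃ S, T.expansion.subtree? (pathNode ξ n) = some S ∧ S.HasPriority p) ∧
        T.expansion.subtree? (pathNode ξ (n + 1)) = some (reached T (c (n + 1))).expansion := by
    intro n hplay hn
    have hset : Settles d w ρ T (c n) (settle d w ρ T (c n)) := by
      refine Classical.epsilon_spec ?_
      by_cases hex : ∃ a k ts, (reached T (c n)).SimpTo a k ts
      · obtain ⟨a, k, ts, hs⟩ := hex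
        obtain ⟨A', h1, h2, ts', h3, h4⟩ := exists_simSteps_of_simpTo hd hstr hwin hs hplay rfl
        refine ⟨A', h1, h2, a, k, ts', h3, ?_⟩
        rw [ExtTree.expansion_of_simpTo hs]
        simp only [h4]
      -- Divergence would put `ω` into the expansion, which a parity tree excludes.
      · push Not at hex
        have h1 := (hT _ _ hn).1
        rw [ExtTree.expansion_of_not_simpTo hex, label_node] at h1
        obtain ⟨o, p, -, -, h⟩ := h1
        exact absurd h nofun
    obtain ⟨hrun, hplay', a, k, ts, htree, hexp⟩ := hset
    set D := settle d w ρ T (c n) with hD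
    rw [hexp] at hn
    obtain ⟨o, p, hp1, hpd, ha⟩ := (hT _ _ hn).1
    rw [label_node] at ha
    subst ha
    have hk : ξ n < k := by
      obtain ⟨S, hS⟩ := hξ (n + 1)
      rw [hpath, subtree?_append, hn, Option.bind_some, subtree?_node_singleton] at hS
      by_contra hk
      rw [dif_neg hk] at hS
      exact absurd hS nofun
    have hmove : Moves T D (ξ n) (c (n + 1)) := by
      rw [hc, ← hD]
      exact Classical.epsilon_spec (p := Moves T D (ξ n)) ⟨_, o, p, k, ts, hk, htree, rfl⟩
    obtain ⟨o', p', k', ts', hk', htree', hc'⟩ := hmove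
    have heq := ExtTree.node_inj (htree.symm.trans htree')
    simp only [Sigma.mk.injEq, Prod.mk.injEq, Symb.lab.injEq] at heq
    obtain ⟨⟨⟨rfl, rfl⟩, rfl⟩, heq⟩ := heq
    obtain rfl := eq_of_heq heq
    have hsub : (current T D).subtree d =
        node (.lab o p) k fun i => tr d (shiftAll (current T D).decls p) (ts i) := by
      rw [Pos.subtree, htree, tr_node]
    -- The settled position has the same arity as the node of the expansion, so the choice of `ρ` is
    -- legal there and the default in `transfer` does not apply.
    have hmv : o = w → ξ n = ρ (current T D).path := by
      intro ho
      have h1 := hag n _ hn ⟨p, by rw [label_node, ho]⟩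
      have h2 := hplay'.subtree?_eq
      rw [hsub] at h2
      have h3 := hstr _ _ h2 ⟨p, by rw [label_node, ho]⟩ (by rw [arity_node]; omega)
      rw [arity_node] at h3
      rw [h1, transfer, if_pos ⟨_, hn, by rw [arity_node]; exact h3⟩]
    refine ⟨p, hp1, hpd, hrun, ?_, ⟨_, hn, o, label_node _ _ _⟩, ?_⟩
    · rw [hc']
      refine ⟨StackStep.push D _ p rfl, hplay', ?_, hp1, hpd, hp1, hpd, le_rfl, fun _ => rfl, nofun⟩
      rw [hsub]
      exact CPath.single _ o p k (fun i => tr d (shiftAll (current T D).decls p) (ts i)) ⟨ξ n, hk⟩ hmv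
    · rw [hpath, hc']
      exact subtree?_concat_node hn ⟨ξ n, hk⟩
  have inv : ∀ n, IsPlay d w ρ T (c n) ∧
      T.expansion.subtree? (pathNode ξ n) = some (reached T (c n)).expansion := by
    intro n
    induction n with
    | zero => exact ⟨trivial, rfl⟩
    | succ n ih =>
      obtain ⟨p, -, -, -, h1, -, h2⟩ := step n ih.1 ih.2
      exact ⟨h1.2, h2⟩
  choose p hp1 hpd hrun hstep hprio _ using fun n => step n (inv n).1 (inv n).2
  obtain ⟨b, p', hb, hbc, hp'⟩ := exists_interleaving hrun hstep
  have hplay : ∀ t, IsPlay d w ρ T (b t) := fun t => by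
    obtain ⟨n, hn⟩ := hbc t
    rcases Relation.ReflTransGen.cases_tail hn with h | ⟨_, -, h⟩
    · exact h ▸ (inv n).1
    · exact h.2
  obtain ⟨P, hP1, hPf, hP, hPmax⟩ := favourable_of_simSteps hwin hplay fun t => (hb t).1
  have hset : {q | T.expansion.InfOften ξ q} = {q | ∃ᶠ n in Filter.atTop, p n = q} := by
    ext q
    refine Filter.frequently_congr (Filter.Eventually.of_forall fun n => ?_)
    obtain ⟨S, hS, o, ho⟩ := hprio n
    refine ⟨?_, fun h => ⟨S, hS, o, h ▸ ho⟩⟩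
    rintro ⟨S', hS', o', ho'⟩
    obtain rfl := Option.some.inj (hS.symm.trans hS')
    exact (Symb.lab.inj (ho.symm.trans ho')).2
  obtain ⟨Q, hQ, hQmax⟩ := exists_isGreatest_frequently hpd
  have hQ1 : 1 ≤ Q := by
    obtain ⟨n, hn⟩ := Filter.Frequently.exists hQ
    exact hn ▸ hp1 n
  -- Interleaving preserves the recurrence only of labels greater than `1`; the value `1` is covered
  -- by both numbers being at least `1`.
  have hPQ : P = Q := by
    refine le_antisymm ?_ ?_
    · rcases hP1.lt_or_eq with h | rfl
      · exact hQmax ((hp' P h).1 (hP h))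
      · exact hQ1
    · rcases hQ1.lt_or_eq with h | rfl
      · exact hPmax Q h ((hp' Q h).2 hQ)
      · exact hP1
  exact ⟨Q, by rw [hset]; exact ⟨hQ, hQmax⟩, hPQ ▸ hPf⟩

end Transfer

end ParityExpansion

theorem mainTheorem3 {V : Type*} [DecidableEq V] (d : ℕ) (hd : 1 ≤ d)
    (T : ParityExpansion.ExtTree V) (hT : ParityExpansion.ExtTree.IsExtParityTree d T)
    (w : ParityExpansion.Player)
    (hw : ParityExpansion.PTree.Wins w
      (ParityExpansion.tr d ParityExpansion.noDecl T)) :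
    ParityExpansion.PTree.Wins w (ParityExpansion.ExtTree.expansion T) := by
  obtain ⟨ρ, hstr, hwin⟩ := hw
  exact ⟨ParityExpansion.transfer d w ρ T, ParityExpansion.isStrategy_transfer, fun ξ hξ hag =>
    ParityExpansion.branchWonBy_of_agrees_transfer hd hT.2 hstr hwin hξ hag⟩
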